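/- Let $k_0$ be a perfect field of characteristic $p>0$, and let $L$ be a function field of dimension $1$ over $k_0$, that is, a finitely generated extension of $k_0$ of transcendence degree $1$. Let $x\in L$ be a local parameter at a place of $L$ of degree $1$, and regard $L$ as a subfield of $k_0((x))$ through the expansion at this place (in other words, a $k_0$-embedding $L\hookrightarrow k_0((x))$ that sends $x$ to $x$ is given). For a place $Q$ of $L/k_0$ (a closed point of the smooth complete curve with function field $L$) let $\deg Q$ be the degree over $k_0$ of its residue field and let $v_Q$ be the normalized order at $Q$, of functions and of differential forms (the order of a form $f\,{\rm d}t$ at $Q$, where $t$ is a local parameter at $Q$, is $v_Q(f)$). Let $g=\max_D(\deg D-\ell(D)+1)$ be the genus of $L$, where $D$ runs over the divisors of $L/k_0$ and $\ell(D)$ is the dimension over $k_0$ of the space consisting of $0$ and of the functions $f$ with $v_Q(f)\ge -D(Q)$ for all $Q$. Let $\deg x=-\sum_{v_Q(x)<0}\deg(Q)\,v_Q(x)$ be the degree of $x$, i.e. the number of poles of $x$ counted with multiplicity, and let $N_x$ be the number of distinct places that are poles of $x$. Let $w\in k_0[[x]]\cap L$ and suppose that the form $\xi=w\,{\rm d}x$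 is not exact in $L$, i.e. that it is not of the shape ${\rm d}\phi$ with $\phi\in L$. Then there is an integer $m\ge 1$ such that the coefficient of $x^{mp-1}$ in the expansion of $w$ is nonzero and $$m\le -\sum_{v_Q(\xi)<0}\deg(Q)\,v_Q(\xi)+2g-1+\deg x+N_x .$$ -/

import Mathlib

open scoped LaurentSeries PowerSeries

noncomputable section

namespace CurveFF

universe u v

/-- `L` is a function field of dimension one over `k`: a finitely generated field extension of
transcendence degree one. -/
structure IsFunctionField (k : Type u) (L : Type v) [Field k] [Field L] [Algebra k L] : Prop where
  fg : (⊤ : IntermediateField k L).FG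
  trdeg_eq_one : Algebra.trdeg k L = 1

/-- A place of `L / k`, that is, a closed point of the smooth complete curve with function field
`L`: a discrete valuation ring of `L` that contains `k`. -/
structure Place (k : Type u) (L : Type v) [Field k] [Field L] [Algebra k L] where
  /-- The local ring of the place. -/
  ring : ValuationSubring L
  algebraMap_mem : ∀ c : k, algebraMap k L c ∈ ring
  isDVR : IsDiscreteValuationRing ring

namespace Place

variable {k : Type u} {L : Type v} [Field k] [Field L] [Algebra k L]

instance instIsDVR (Q : Place k L) : IsDiscreteValuationRing Q.ring := Q.isDVR

instance instAlgebra (Q : Place k L) : Algebra k Q.ring :=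
  ((algebraMap k L).codRestrict Q.ring.toSubring Q.algebraMap_mem).toAlgebra

/-- The degree of a place: the degree over `k` of its residue field. -/
def deg (Q : Place k L) : ℕ := Module.finrank k (IsLocalRing.ResidueField Q.ring)

/-- The normalized valuation of the place `Q`, written multiplicatively. -/
def val (Q : Place k L) : Valuation L (WithZero (Multiplicative ℤ)) :=
  (IsDiscreteValuationRing.maximalIdeal Q.ring).valuation L

/-- The normalized order function `v_Q` on `L` (with the convention that the order of `0`
is `0`). -/
def ord (Q : Place k L) (f : L) : ℤ := -WithZero.log (Q.val f)

theorem val_algebraMap_le_one (Q : Place k L) (c : k) : Q.val (algebraMap k L c) ≤ 1 :=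
  (IsDiscreteValuationRing.maximalIdeal Q.ring).valuation_le_one
    (⟨algebraMap k L c, Q.algebraMap_mem c⟩ : Q.ring)

/-- Local parameters exist at every place. -/
theorem exists_irreducible (Q : Place k L) : ∃ t : Q.ring, Irreducible t :=
  IsDiscreteValuationRing.exists_irreducible Q.ring

/-- A local parameter at `Q`. -/
def localParam (Q : Place k L) : L := (Q.exists_irreducible.choose : Q.ring)

open Classical in
/-- The order `v_Q(ξ)` of a differential form: `v_Q(f)` where `ξ = f dt` and `t` is a local
parameter at `Q`. (For `k` perfect and `L` a function field, `dt` is a basis of the differentials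
and the order does not depend on the local parameter.) -/
def ordForm (Q : Place k L) (ξ : Ω[L⁄k]) : ℤ :=
  if h : ∃ f : L, ξ = f • KaehlerDifferential.D k L Q.localParam then Q.ord h.choose else 0

end Place

section

variable (k : Type u) {L : Type v} [Field k] [Field L] [Algebra k L]

/-- `∑ deg(Q) v_Q(ξ)`, over the poles `Q` of the differential form `ξ`. -/
def poleSum (ξ : Ω[L⁄k]) : ℤ :=
  ∑ᶠ (Q : Place k L) (_ : Q.ordForm ξ < 0), (Q.deg : ℤ) * Q.ordForm ξ

/-- The degree of a function: the number of its poles, counted with multiplicity (and with the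
degree of the place). -/
def degFun (f : L) : ℤ :=
  ∑ᶠ (Q : Place k L) (_ : Q.ord f < 0), (Q.deg : ℤ) * (-Q.ord f)

/-- The number of distinct poles (places, each counted once) of a function. -/
def numPoles (f : L) : ℕ := {Q : Place k L | Q.ord f < 0}.ncard

end

section

variable (k : Type u) (L : Type v) [Field k] [Field L] [Algebra k L]

/-- The degree of a divisor. -/
def divDeg (D : Place k L →₀ ℤ) : ℤ := D.sum fun Q n => n * (Q.deg : ℤ)

/-- The Riemann-Roch space `L(D)`: the functions with `v_Q(f) ≥ -D(Q)` at every place (the zero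
function included). -/
def rrSpace (D : Place k L →₀ ℤ) : Submodule k L where
  carrier := {f | ∀ Q : Place k L, Q.val f ≤ WithZero.exp (D Q)}
  zero_mem' := fun Q => by simp
  add_mem' := fun {f g} hf hg Q => (Q.val.map_add f g).trans (max_le (hf Q) (hg Q))
  smul_mem' := fun c f hf Q => by
    rw [Algebra.smul_def, map_mul]
    calc Q.val (algebraMap k L c) * Q.val f ≤ 1 * WithZero.exp (D Q) :=
          mul_le_mul' (Q.val_algebraMap_le_one c) (hf Q)
      _ = WithZero.exp (D Q) := one_mul _

/-- The dimension `ℓ(D)` of the Riemann-Roch space. -/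
def rrDim (D : Place k L →₀ ℤ) : ℕ := Module.finrank k (rrSpace k L D)

/-- The genus of `L`, following Riemann: the maximum of `deg D - ℓ(D) + 1` over all divisors. -/
def genus : ℤ := ⨆ D : Place k L →₀ ℤ, (divDeg k L D - (rrDim k L D : ℤ) + 1)

end

end CurveFF

end

/-! Let `P` be the place of degree one given by the expansion in `x`. Over a perfect field, `1, x,
…, x^(p-1)` is a basis of `L` over the field of `p`-th powers, and a sum `∑ aᵢᵖ xⁱ dx` is exact once
its last term `i = p - 1` is absent. That term carries precisely the exponents congruent to `-1`
modulo `p`. As `ξ` is not exact, some coefficient of `x^(mp-1)` in `w` is nonzero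
(`exact_of_coeff_eq_zero`); take `m` minimal.

Let `E ≤ 0` be the polar part of the divisor of `ξ`. Suppose that `f` vanishes at each pole of `ξ`
at least to the order of that pole, is regular at the other places except `P`, and has at `P` a pole
of order at most `m`. Then `fᵖ ξ` is regular outside `P`, so its residue at `P` is zero
(`residue_eq_zero`). By minimality of `m` this residue is the `p`-th power of the coefficient of
`x^(-m)` in `f`, times the coefficient of `x^(mp-1)` in `w` (`coeff_pow_mul_coe`). Hence the pole of
`f` at `P` never has order exactly `m`.

So `D = E + (m - 1)P` has a gap at `P`: passing from `D` to `D + P` brings no new function.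
Multiplying functions of `L(D - nP)` by functions of `L((n+1)P)`, and using Riemann's inequality
twice, one gets `deg D ≤ 2g - 2` (`divDeg_le_of_gap`). This is `m ≤ -deg E + 2g - 1`, which is
stronger than the bound claimed by the nonnegative amount `deg x + N_x`.

The background is built from the definitions: Riemann's theorem and strong approximation, and the
residue theorem for forms with a single pole, obtained from the vanishing of the trace of a
commutator. -/

noncomputable section

namespace CurveFF

universe u v

/-! ### Orders and leading coefficients at one place. -/

section

namespace Place

variable {k : Type u} {L : Type v} [Field k] [Field L] [Algebra k L]

/-- The order of `f` at `Q` is at least `n` (true for `f = 0`). -/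
def Ge (Q : Place k L) (f : L) (n : ℤ) : Prop := Q.val f ≤ WithZero.exp (-n)

theorem ge_zero (Q : Place k L) (n : ℤ) : Q.Ge 0 n := by simp [Ge]

theorem Ge.mono {Q : Place k L} {f : L} {m n : ℤ} (h : Q.Ge f n) (hmn : m ≤ n) : Q.Ge f m :=
  le_trans h (by rw [WithZero.exp_le_exp]; omega)

theorem Ge.add {Q : Place k L} {f g : L} {n : ℤ} (hf : Q.Ge f n) (hg : Q.Ge g n) :
    Q.Ge (f + g) n := (Q.val.map_add f g).trans (max_le hf hg)

theorem Ge.neg {Q : Place k L} {f : L} {n : ℤ} (hf : Q.Ge f n) : Q.Ge (-f) n := by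
  rw [Ge, Valuation.map_neg]; exact hf

theorem Ge.sub {Q : Place k L} {f g : L} {n : ℤ} (hf : Q.Ge f n) (hg : Q.Ge g n) :
    Q.Ge (f - g) n := by
  rw [sub_eq_add_neg]; exact hf.add hg.neg

theorem Ge.mul {Q : Place k L} {f g : L} {m n : ℤ} (hf : Q.Ge f m) (hg : Q.Ge g n) :
    Q.Ge (f * g) (m + n) := by
  rw [Ge, map_mul, neg_add, WithZero.exp_add]
  exact mul_le_mul' hf hg

theorem Ge.pow {Q : Place k L} {f : L} {n : ℤ} (hf : Q.Ge f n) (j : ℕ) :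
    Q.Ge (f ^ j) (j * n) := by
  induction j with
  | zero => simp [Ge]
  | succ j ih =>
    rw [pow_succ, Nat.cast_succ, add_mul, one_mul]
    exact ih.mul hf

theorem ge_algebraMap (Q : Place k L) (c : k) : Q.Ge (algebraMap k L c) 0 := by
  simpa [Ge] using Q.val_algebraMap_le_one c

theorem ge_natCast (Q : Place k L) (n : ℕ) : Q.Ge (n : L) 0 := by
  simpa using Q.ge_algebraMap (n : k)

theorem Ge.smul {Q : Place k L} {f : L} {n : ℤ} (hf : Q.Ge f n) (c : k) : Q.Ge (c • f) n := by
  rw [Algebra.smul_def]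
  simpa using (Q.ge_algebraMap c).mul hf

theorem Ge.sum {Q : Place k L} {ι : Type*} {s : Finset ι} {f : ι → L} {n : ℤ}
    (h : ∀ i ∈ s, Q.Ge (f i) n) : Q.Ge (∑ i ∈ s, f i) n :=
  Finset.sum_induction f (Q.Ge · n) (fun _ _ => Ge.add) (Q.ge_zero n) h

theorem val_eq_exp (Q : Place k L) {f : L} (hf : f ≠ 0) : Q.val f = WithZero.exp (-Q.ord f) := by
  rw [ord, neg_neg, WithZero.exp_log ((Valuation.ne_zero_iff _).2 hf)]

theorem ge_iff (Q : Place k L) {f : L} (hf : f ≠ 0) {n : ℤ} : Q.Ge f n ↔ n ≤ Q.ord f := by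
  rw [Ge, Q.val_eq_exp hf, WithZero.exp_le_exp, neg_le_neg_iff]

theorem ge_ord (Q : Place k L) (f : L) : Q.Ge f (Q.ord f) := by
  by_cases hf : f = 0
  · rw [hf]; exact Q.ge_zero _
  · exact (Q.ge_iff hf).2 le_rfl

theorem ord_mul (Q : Place k L) {f g : L} (hf : f ≠ 0) (hg : g ≠ 0) :
    Q.ord (f * g) = Q.ord f + Q.ord g := by
  have := Q.val_eq_exp (mul_ne_zero hf hg)
  rw [map_mul, Q.val_eq_exp hf, Q.val_eq_exp hg, ← WithZero.exp_add, WithZero.exp_inj] at this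
  omega

theorem ord_inv (Q : Place k L) (f : L) : Q.ord f⁻¹ = -Q.ord f := by
  rw [ord, ord, map_inv₀, WithZero.log_inv]

@[simp] theorem ord_one (Q : Place k L) : Q.ord 1 = 0 := by simp [ord]

@[simp] theorem ord_zero (Q : Place k L) : Q.ord 0 = 0 := by simp [ord]

theorem ord_pow (Q : Place k L) (f : L) (n : ℕ) : Q.ord (f ^ n) = n * Q.ord f := by
  rw [ord, ord, map_pow, WithZero.log_pow]; simp

theorem ord_zpow (Q : Place k L) (f : L) (n : ℤ) : Q.ord (f ^ n) = n * Q.ord f := by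
  rw [ord, ord, map_zpow₀, WithZero.log_zpow]; simp

theorem ge_zpow (Q : Place k L) (f : L) (n : ℤ) : Q.Ge (f ^ n) (n * Q.ord f) := by
  rw [← ord_zpow]; exact Q.ge_ord _

theorem ord_add_eq (Q : Place k L) {f g : L} (hf : f ≠ 0) (hg : Q.Ge g (Q.ord f + 1)) :
    f + g ≠ 0 ∧ Q.ord (f + g) = Q.ord f := by
  have h : Q.val g < Q.val f := by
    rw [Q.val_eq_exp hf]
    exact lt_of_le_of_lt hg (by rw [WithZero.exp_lt_exp]; omega)
  have h2 := Valuation.map_add_eq_of_lt_left Q.val h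
  refine ⟨fun h0 => ?_, by rw [ord, ord, h2]⟩
  rw [h0, map_zero, eq_comm, Valuation.zero_iff] at h2
  exact hf h2

theorem mem_ring_iff (Q : Place k L) (f : L) : f ∈ Q.ring ↔ Q.Ge f 0 := by
  rw [Ge, neg_zero, WithZero.exp_zero]
  constructor
  · intro h
    exact (IsDiscreteValuationRing.maximalIdeal Q.ring).valuation_le_one (⟨f, h⟩ : Q.ring)
  · intro h
    obtain ⟨a, rfl⟩ := IsDiscreteValuationRing.exists_lift_of_le_one (A := Q.ring) (K := L) h
    exact a.2

theorem ext_ge {Q Q' : Place k L} (h : ∀ f, Q.Ge f 0 → Q'.Ge f 0) (h' : ∀ f, Q'.Ge f 0 → Q.Ge f 0) :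
    Q = Q' := by
  have hr : Q.ring = Q'.ring := by
    ext f; rw [mem_ring_iff, mem_ring_iff]; exact ⟨h f, h' f⟩
  cases Q; cases Q'; cases hr; rfl

theorem residue_eq_zero_iff (Q : Place k L) (a : Q.ring) :
    IsLocalRing.residue Q.ring a = 0 ↔ Q.Ge (a : L) 1 := by
  have h1 : Q.Ge (a : L) 1 ↔ Q.val (a : L) < 1 := by
    by_cases ha : (a : L) = 0
    · simp [ha, Ge]
    · rw [Q.ge_iff ha, Q.val_eq_exp ha, ← WithZero.exp_zero, WithZero.exp_lt_exp]; omega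
  rw [h1, IsLocalRing.residue_eq_zero_iff]
  exact ((IsDiscreteValuationRing.maximalIdeal Q.ring).valuation_lt_one_iff_mem (K := L) a).symm

theorem localParam_ne_zero (Q : Place k L) : Q.localParam ≠ 0 := by
  have := Q.exists_irreducible.choose_spec.ne_zero
  simpa [localParam] using this

theorem ord_localParam (Q : Place k L) : Q.ord Q.localParam = 1 := by
  have h := Q.exists_irreducible.choose_spec
  have : Q.val Q.localParam = WithZero.exp (-1 : ℤ) := by
    have h1 := (IsDiscreteValuationRing.maximalIdeal Q.ring).valuation_of_algebraMap (K := L)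
      Q.exists_irreducible.choose
    refine h1.trans ?_
    exact (IsDiscreteValuationRing.maximalIdeal Q.ring).intValuation_singleton h.ne_zero
      h.maximalIdeal_eq
  rw [ord, this]; simp

/-- The functions of order at least `n` at `Q`. -/
def geSub (Q : Place k L) (n : ℤ) : Submodule k L where
  carrier := {f | Q.Ge f n}
  zero_mem' := Q.ge_zero n
  add_mem' := Ge.add
  smul_mem' := fun c _ hf => Ge.smul hf c

theorem mem_geSub {Q : Place k L} {n : ℤ} {f : L} : f ∈ Q.geSub n ↔ Q.Ge f n := Iff.rfl

theorem ge_mul_localParam (Q : Place k L) {f : L} {n : ℤ} (m : ℤ) (h : Q.Ge f n) :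
    Q.Ge (f * Q.localParam ^ m) (n + m) := by
  have := Q.ge_zpow Q.localParam m
  rw [ord_localParam, mul_one] at this
  exact h.mul this

/-- The leading coefficient at `Q` of the functions of order at least `n`. -/
def lead (Q : Place k L) (n : ℤ) : Q.geSub n →ₗ[k] IsLocalRing.ResidueField Q.ring where
  toFun f := IsLocalRing.residue Q.ring
    ⟨f * Q.localParam ^ (-n), (Q.mem_ring_iff _).2 (by
      simpa using Q.ge_mul_localParam (-n) (mem_geSub.1 f.2))⟩
  map_add' f g := by
    rw [← map_add]; congr 1; ext; simp [add_mul]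
  map_smul' c f := by
    rw [RingHom.id_apply, Algebra.smul_def]
    change _ = IsLocalRing.residue Q.ring (algebraMap k Q.ring c) * _
    rw [← map_mul]; congr 1; ext
    simp only [Submodule.coe_smul, Algebra.smul_def]
    exact mul_assoc _ _ _

theorem lead_eq_zero_iff (Q : Place k L) (n : ℤ) (f : Q.geSub n) :
    Q.lead n f = 0 ↔ Q.Ge (f : L) (n + 1) := by
  refine (Q.residue_eq_zero_iff _).trans ⟨fun h => ?_, fun h => ?_⟩
  · have := Q.ge_mul_localParam n h
    simp only [zpow_neg] at this
    rw [mul_assoc, inv_mul_cancel₀ (zpow_ne_zero _ Q.localParam_ne_zero), mul_one, add_comm] at this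
    exact this
  · simpa using Q.ge_mul_localParam (-n) h

theorem lead_surjective (Q : Place k L) (n : ℤ) : Function.Surjective (Q.lead n) := by
  intro c
  obtain ⟨a, rfl⟩ := IsLocalRing.residue_surjective c
  have ha : Q.Ge (a : L) 0 := (Q.mem_ring_iff _).1 a.2
  refine ⟨⟨a * Q.localParam ^ n, by simpa [mem_geSub] using Q.ge_mul_localParam n ha⟩, ?_⟩
  change IsLocalRing.residue Q.ring _ = _
  congr 1; ext
  simp only [zpow_neg]
  rw [mul_assoc, mul_inv_cancel₀ (zpow_ne_zero _ Q.localParam_ne_zero), mul_one]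

theorem lead_eq_iff (Q : Place k L) (n : ℤ) (f g : Q.geSub n) :
    Q.lead n f = Q.lead n g ↔ Q.Ge ((f : L) - g) (n + 1) := by
  rw [← sub_eq_zero, ← map_sub, lead_eq_zero_iff]; rfl

/-- The leading coefficient on a subspace of functions of order at least `n`. -/
def leadOn (Q : Place k L) {n : ℤ} {N : Submodule k L} (hN : N ≤ Q.geSub n) :
    N →ₗ[k] IsLocalRing.ResidueField Q.ring := Q.lead n ∘ₗ Submodule.inclusion hN

/-- The case of interest is `N = L(D + Q)` and `N' = L(D)`: their quotient embeds in the residue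
field of `Q`, which bounds the growth of `ℓ` by `deg Q`. -/
theorem ker_leadOn (Q : Place k L) {n : ℤ} {N N' : Submodule k L} (hN : N ≤ Q.geSub n)
    (hN' : ∀ f, f ∈ N' ↔ f ∈ N ∧ Q.Ge f (n + 1)) :
    Nonempty (LinearMap.ker (Q.leadOn hN) ≃ₗ[k] N') := by
  have hle : N' ≤ N := fun f hf => ((hN' f).1 hf).1
  have : LinearMap.ker (Q.leadOn hN) = Submodule.comap N.subtype N' := by
    ext f
    rw [LinearMap.mem_ker]
    refine (Q.lead_eq_zero_iff n _).trans ?_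
    rw [Submodule.mem_comap, hN']
    simp
  rw [this]
  exact ⟨Submodule.comapSubtypeEquivOfLe hle⟩

section finite

variable (Q : Place k L) [FiniteDimensional k (IsLocalRing.ResidueField Q.ring)]
  {n : ℤ} {N N' : Submodule k L} (hN : N ≤ Q.geSub n)
  (hN' : ∀ f, f ∈ N' ↔ f ∈ N ∧ Q.Ge f (n + 1))
include hN hN'

theorem finiteDimensional_of_step [FiniteDimensional k N'] : FiniteDimensional k N := by
  obtain ⟨e⟩ := Q.ker_leadOn hN hN'
  have : FiniteDimensional k (LinearMap.ker (Q.leadOn hN)) := e.symm.finiteDimensional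
  have := (Q.leadOn hN).quotKerEquivRange.symm.finiteDimensional
  exact Module.Finite.of_submodule_quotient (LinearMap.ker (Q.leadOn hN))

theorem finrank_step_le [FiniteDimensional k N] :
    Module.finrank k N ≤ Module.finrank k N' + Q.deg := by
  obtain ⟨e⟩ := Q.ker_leadOn hN hN'
  rw [← (Q.leadOn hN).finrank_range_add_finrank_ker, e.finrank_eq, add_comm]
  exact Nat.add_le_add_left (Submodule.finrank_le _) _

/-- If the dimension grows by the full degree of `Q`, every leading coefficient is attained. This is
the single step from which strong approximation is built. -/
theorem exists_sub_ge_of_finrank_step [FiniteDimensional k N]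
    (h : Module.finrank k N = Module.finrank k N' + Q.deg) (y : L) (hy : Q.Ge y n) :
    ∃ f ∈ N, Q.Ge (f - y) (n + 1) := by
  obtain ⟨e⟩ := Q.ker_leadOn hN hN'
  rw [← (Q.leadOn hN).finrank_range_add_finrank_ker, e.finrank_eq, add_comm] at h
  have htop : LinearMap.range (Q.leadOn hN) = ⊤ :=
    Submodule.eq_top_of_finrank_eq (Nat.add_left_cancel h)
  obtain ⟨f, hf⟩ := LinearMap.range_eq_top.1 htop (Q.lead n ⟨y, hy⟩)
  exact ⟨f, f.2, (Q.lead_eq_iff n _ _).1 hf⟩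

end finite

end Place

end

/-! ### Finiteness over `k(t)`, discreteness of valuation rings, existence of poles. -/

section

variable {k : Type u} {L : Type v} [Field k] [Field L] [Algebra k L]

open Polynomial IntermediateField IntermediateField.algebraAdjoinAdjoin in
/-- Vectors of a `k[t]`-submodule `M` of `L` that are linearly independent over `k` modulo `tM`
are linearly independent over `k(t)`. -/
theorem linearIndependent_adjoin_of_mod {t : L} (ht : t ≠ 0) {M : Submodule k L}
    (hM : ∀ f ∈ M, t * f ∈ M) {ι : Type*} [Fintype ι] {v : ι → L} (hv : ∀ i, v i ∈ M)
    (hind : ∀ c : ι → k, (∃ f ∈ M, ∑ i, c i • v i = t * f) → ∀ i, c i = 0) :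
    LinearIndependent k⟮t⟯ v := by
  -- Induction on a degree bound for the coefficients: a relation over `k[t]` read modulo `tM` kills
  -- all constant terms, and then `t` can be cancelled.
  have key : ∀ d : ℕ, ∀ q : ι → k[X], (∀ i, (q i).degree < d) →
      ∑ i, aeval t (q i) * v i = 0 → ∀ i, q i = 0 := by
    intro d
    induction d with
    | zero => intro q hq _ i; simpa using hq i
    | succ d ih =>
      intro q hq h0
      have hmem : ∀ r : k[X], ∀ f ∈ M, aeval t r * f ∈ M := by
        intro r f hf
        induction r using Polynomial.induction_on' with
        | add a b ha hb => rw [map_add, add_mul]; exact M.add_mem ha hb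
        | monomial n a =>
          rw [aeval_monomial, mul_assoc, ← Algebra.smul_def]
          refine M.smul_mem a ?_
          induction n with
          | zero => simpa using hf
          | succ n ihn => rw [pow_succ', mul_assoc]; exact hM _ ihn
      have hsplit : ∀ i, aeval t (q i) * v i =
          t * (aeval t (q i).divX * v i) + (q i).coeff 0 • v i := by
        intro i
        conv_lhs => rw [← divX_mul_X_add (q i)]
        simp only [map_add, map_mul, aeval_X, aeval_C, Algebra.smul_def]
        ring
      simp only [hsplit, Finset.sum_add_distrib, ← Finset.mul_sum] at h0
      have hc : ∀ i, (q i).coeff 0 = 0 := by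
        refine hind _ ⟨-∑ i, aeval t (q i).divX * v i, ?_, ?_⟩
        · exact M.neg_mem (M.sum_mem fun i _ => hmem _ _ (hv i))
        · rw [mul_neg]; exact (neg_eq_of_add_eq_zero_right h0).symm
      simp only [hc, zero_smul, Finset.sum_const_zero, add_zero, mul_eq_zero, ht, false_or] at h0
      have hdiv := ih (fun i => (q i).divX) (fun i => by
        by_cases hqi : q i = 0
        · simp [hqi, bot_lt_iff_ne_bot]
        · have h1 := degree_divX_lt hqi
          have h2 := hq i
          rw [degree_lt_iff_coeff_zero] at h2 ⊢
          intro m hm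
          rw [coeff_divX]; exact h2 _ (by omega)) h0
      intro i
      rw [← divX_mul_X_add (q i), hdiv i, hc i]; simp
  rw [← LinearIndependent.iff_fractionRing (Algebra.adjoin k {t}) k⟮t⟯, Fintype.linearIndependent_iff]
  intro g hg
  have hex : ∀ i, ∃ r : k[X], aeval t r = (g i : L) := fun i => by
    have := (g i).2
    exact (Algebra.adjoin_singleton_eq_range_aeval k t).le this
  choose q hq using hex
  have h0 : ∑ i, aeval t (q i) * v i = 0 := by
    rw [← hg]; exact Finset.sum_congr rfl fun i _ => by rw [hq]; rfl
  have := key (Finset.univ.sup (fun i => (q i).natDegree) + 1) q (fun i => by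
    refine lt_of_le_of_lt degree_le_natDegree (Nat.cast_lt.2 (Nat.lt_succ_of_le ?_))
    exact Finset.le_sup (f := fun i => (q i).natDegree) (Finset.mem_univ i)) h0
  intro i
  ext
  rw [← hq, this i]; simp

namespace IsFunctionField

variable (hL : IsFunctionField k L)
include hL

open IntermediateField in
-- In transcendence degree one, `t` alone is a transcendence basis, so `L` is algebraic and finitely
-- generated over `k(t)`.
theorem finiteDimensional {t : L} (ht : Transcendental k t) : FiniteDimensional k⟮t⟯ L := by
  have hai : AlgebraicIndependent k (fun _ : Unit => t) :=
    (algebraicIndependent_unique_type_iff).2 ht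
  have hb := hai.isTranscendenceBasis_of_lift_trdeg_le_of_finite (by rw [hL.trdeg_eq_one]; simp)
  have := hb.isAlgebraic_field
  rw [Set.range_const] at this
  have hfg : Algebra.EssFiniteType k L := by
    have h1 := essFiniteType_iff.2 hL.fg
    exact Algebra.EssFiniteType.of_surjective
      (IntermediateField.topEquiv (F := k) (E := L)).toAlgHom
      (IntermediateField.topEquiv (F := k) (E := L)).surjective
  have : Algebra.EssFiniteType k⟮t⟯ L := Algebra.EssFiniteType.of_comp k _ _
  exact Algebra.finite_of_essFiniteType_of_isAlgebraic

open IntermediateField in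
theorem card_le_finrank {t : L} (ht : Transcendental k t) {M : Submodule k L}
    (hM : ∀ f ∈ M, t * f ∈ M) {ι : Type*} [Fintype ι] {v : ι → L} (hv : ∀ i, v i ∈ M)
    (hind : ∀ c : ι → k, (∃ f ∈ M, ∑ i, c i • v i = t * f) → ∀ i, c i = 0) :
    Fintype.card ι ≤ Module.finrank k⟮t⟯ L := by
  have := hL.finiteDimensional ht
  exact (linearIndependent_adjoin_of_mod (fun h => ht (by rw [h]; exact isAlgebraic_zero)) hM hv hind).fintype_card_le_finrank

open IntermediateField in
/-- A nontrivial valuation ring of a function field is discrete. -/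
theorem isDVR (V : ValuationSubring L) (hk : ∀ c : k, algebraMap k L c ∈ V) {y : L} (hy : y ∉ V) :
    IsDiscreteValuationRing V := by
  let _ : Algebra k V := ((algebraMap k L).codRestrict V.toSubring hk).toAlgebra
  have hsc : IsScalarTower k V L := IsScalarTower.of_algebraMap_eq fun _ => rfl
  -- If `a` were algebraic, `a⁻¹` would be a polynomial in `a`, hence in `V`.
  have htr : ∀ a : V, a ≠ 0 → ¬ IsUnit a → Transcendental k (a : L) := by
    intro a ha hu halg
    apply hu
    have ha0 : (a : L) ≠ 0 := by simpa using ha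
    have hi : (a : L)⁻¹ ∈ Algebra.adjoin k {(a : L)} := halg.isIntegral.inv_mem_adjoin
    have hle : Algebra.adjoin k {(a : L)} ≤ (IsScalarTower.toAlgHom k V L).range := by
      rw [Algebra.adjoin_le_iff]
      rintro _ rfl
      exact ⟨a, rfl⟩
    obtain ⟨b, hb⟩ := hle hi
    refine IsUnit.of_mul_eq_one b ?_
    ext
    have hb' : (b : L) = (a : L)⁻¹ := hb
    simp [hb', ha0]
  have hnoeth : IsNoetherianRing V := by
    rw [isNoetherianRing_iff_ideal_fg]
    intro I
    by_cases hI : I = ⊥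
    · rw [hI]; exact Submodule.fg_bot
    obtain ⟨a, haI, ha⟩ := Submodule.exists_mem_ne_zero_of_ne_bot hI
    by_cases hu : IsUnit a
    · rw [Ideal.eq_top_of_isUnit_mem I haI hu]; exact Ideal.fg_top _
    have ht := htr a ha hu
    -- Lifts of independent classes modulo `a` are independent over `k(a)`, so `V/aV` has dimension
    -- at most `[L : k(a)]`. An ideal containing `a` is therefore finitely generated.
    have hrank : Module.rank k (V ⧸ Ideal.span {a}) ≤ (Module.finrank k⟮(a : L)⟯ L : ℕ) := by
      refine rank_le fun s hs => ?_
      choose r hr using fun i : s => Ideal.Quotient.mk_surjective (i : V ⧸ Ideal.span {a})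
      have := hL.card_le_finrank ht (M := LinearMap.range (IsScalarTower.toAlgHom k V L).toLinearMap)
        (v := fun i => (r i : L)) (by
          rintro _ ⟨b, rfl⟩
          exact ⟨a * b, rfl⟩) (fun i => ⟨r i, rfl⟩) (by
          rintro c ⟨_, ⟨b, rfl⟩, hb⟩
          rw [Fintype.linearIndependent_iff] at hs
          refine hs c ?_
          have h2 : ∑ i, c i • r i = a * b := by
            apply Subtype.ext
            refine Eq.trans ?_ hb
            change algebraMap V L _ = _
            rw [map_sum]
            exact Finset.sum_congr rfl fun i _ => by
              rw [Algebra.smul_def, Algebra.smul_def, map_mul]; rfl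
          have h3 : ∑ i, c i • (i : V ⧸ Ideal.span {a}) =
              Ideal.Quotient.mk (Ideal.span {a}) (∑ i, c i • r i) := by
            rw [map_sum]
            refine Finset.sum_congr rfl fun i _ => ?_
            rw [← hr i]; rfl
          rw [h3, h2, Ideal.Quotient.eq_zero_iff_mem]
          exact Ideal.mul_mem_right _ _ (Ideal.mem_span_singleton_self a))
      simpa using this
    have hfin : Module.Finite k (V ⧸ Ideal.span {a}) :=
      Module.rank_lt_aleph0_iff.1 (hrank.trans_lt (Cardinal.natCast_lt_aleph0))
    have hn : IsNoetherian V (V ⧸ Ideal.span {a}) := isNoetherian_of_tower k inferInstance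
    refine Submodule.fg_of_fg_map_of_fg_inf_ker (Submodule.mkQ (Ideal.span {a})) ?_ ?_
    · exact IsNoetherian.noetherian _
    · rw [Submodule.ker_mkQ, inf_eq_right.2 ((Ideal.span_singleton_le_iff_mem I).2 haI)]
      exact ⟨{a}, by simp⟩
  have hnf : ¬ IsField V := by
    intro hf
    have hy' : y⁻¹ ∈ V := (V.mem_or_inv_mem y).resolve_left hy
    have hy0 : (⟨y⁻¹, hy'⟩ : V) ≠ 0 := by
      intro h
      have := congrArg Subtype.val h
      simp only [ZeroMemClass.coe_zero, inv_eq_zero] at this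
      exact hy (this ▸ V.zero_mem)
    obtain ⟨b, hb⟩ := hf.mul_inv_cancel hy0
    have hb' := congrArg Subtype.val hb
    have hyne : y ≠ 0 := fun h => hy (h ▸ V.zero_mem)
    have : (b : L) = y := by
      have h1 : y⁻¹ * (b : L) = 1 := hb'
      field_simp at h1; exact h1
    exact hy (this ▸ b.2)
  exact ((IsDiscreteValuationRing.TFAE V hnf).out 1 0).1 (inferInstance : ValuationRing V)

/-- A function that is not algebraic over `k` has a pole. -/
theorem exists_pole {f : L} (hf : Transcendental k f) : ∃ Q : Place k L, ¬ Q.Ge f 0 := by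
  -- The integral closure of `k` is an intersection of valuation rings, one of which must miss `f`.
  obtain ⟨V, hV, hfV⟩ := Subring.exists_le_valuationSubring_of_isIntegrallyClosedIn
    (R := (integralClosure k L).toSubring) (x := f) (fun h => hf (IsIntegral.isAlgebraic h))
  have hk : ∀ c : k, algebraMap k L c ∈ V := fun c => hV (isIntegral_algebraMap : IsIntegral k (algebraMap k L c))
  exact ⟨⟨V, hk, hL.isDVR V hk hfV⟩, fun h => hfV ((Place.mem_ring_iff _ _).2 h)⟩

end IsFunctionField

end

/-! ### Weak approximation and the number of zeros of a function. -/

section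

variable {k : Type u} {L : Type v} [Field k] [Field L] [Algebra k L]

namespace Place

theorem exists_ord_neg_of_ne {Q Q' : Place k L} (h : Q ≠ Q') :
    ∃ f : L, f ≠ 0 ∧ 0 ≤ Q.ord f ∧ Q'.ord f < 0 := by
  by_contra! hcon
  have hle : ∀ f, Q.Ge f 0 → Q'.Ge f 0 := by
    intro f hf
    by_cases h0 : f = 0
    · rw [h0]; exact ge_zero _ _
    · rw [ge_iff _ h0] at hf ⊢; exact hcon f h0 hf
  refine h (ext_ge hle fun f hf => ?_)
  by_contra hfQ
  have hf0 : f ≠ 0 := fun h0 => hfQ (h0 ▸ ge_zero _ _)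
  rw [ge_iff _ hf0] at hf hfQ
  push Not at hfQ
  have hunit : ∀ u : L, u ≠ 0 → Q.ord u = 0 → Q'.ord u = 0 := by
    intro u hu hu0
    have h1 := hcon u hu hu0.ge
    have h2 := hcon u⁻¹ (inv_ne_zero hu) (by rw [ord_inv, hu0, neg_zero])
    rw [ord_inv] at h2; omega
  -- Inclusion of the valuation rings makes the order at `Q'` a constant multiple of the order at
  -- `Q`. The function `f` forces the constant to be zero, which a local parameter at `Q'`
  -- contradicts.
  have hall : ∀ g : L, g ≠ 0 → Q'.ord g = Q.ord g * Q'.ord Q.localParam := by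
    intro g hg
    have ht := zpow_ne_zero (-Q.ord g) Q.localParam_ne_zero
    have h1 := hunit (g * Q.localParam ^ (-Q.ord g)) (mul_ne_zero hg ht)
      (by rw [ord_mul _ hg ht, ord_zpow, ord_localParam]; ring)
    rw [ord_mul _ hg ht, ord_zpow] at h1
    linarith
  have h1 := hcon Q.localParam Q.localParam_ne_zero (by rw [ord_localParam]; norm_num)
  have h2 := hall f hf0
  have h3 : Q'.ord Q.localParam = 0 := by nlinarith
  have h4 := hall Q'.localParam Q'.localParam_ne_zero
  rw [ord_localParam, h3] at h4
  omega

theorem exists_pos_neg {Q Q' : Place k L} (h : Q ≠ Q') :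
    ∃ f : L, f ≠ 0 ∧ 0 < Q.ord f ∧ Q'.ord f < 0 := by
  obtain ⟨f, hf, h1, h2⟩ := exists_ord_neg_of_ne h
  obtain ⟨g, hg, h3, h4⟩ := exists_ord_neg_of_ne h.symm
  refine ⟨f * g⁻¹, mul_ne_zero hf (inv_ne_zero hg), ?_, ?_⟩ <;>
    rw [ord_mul _ hf (inv_ne_zero hg), ord_inv] <;> omega

theorem ord_add_of_lt (Q : Place k L) {f g : L} (hf : f ≠ 0) (hg : g ≠ 0)
    (h : Q.ord f < Q.ord g) : f + g ≠ 0 ∧ Q.ord (f + g) = Q.ord f :=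
  Q.ord_add_eq hf ((Q.ge_iff hg).2 h)

theorem exists_pos_forall_neg (Q : Place k L) (S : Finset (Place k L)) (hQ : Q ∉ S) :
    ∃ f : L, f ≠ 0 ∧ 0 < Q.ord f ∧ ∀ Q' ∈ S, Q'.ord f < 0 := by
  classical
  induction S using Finset.induction_on with
  | empty => exact ⟨Q.localParam, Q.localParam_ne_zero, by rw [ord_localParam]; norm_num, by simp⟩
  | insert Q' S hQ' ih =>
    rw [Finset.mem_insert, not_or] at hQ
    obtain ⟨z, hz, hzQ, hzS⟩ := ih hQ.2
    by_cases hzQ' : Q'.ord z < 0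
    · exact ⟨z, hz, hzQ, by simpa using ⟨hzQ', hzS⟩⟩
    obtain ⟨y, hy, hyQ, hyQ'⟩ := exists_pos_neg hQ.1
    -- For `R ∈ S` the order of `y ^ r` is either `0` or larger in absolute value than the nonzero
    -- order of `z`, so the two orders never coincide and `z + y ^ r` keeps a pole at `R`.
    set r : ℕ := 1 + ∑ R ∈ S, (R.ord z).natAbs with hr
    have hyr : y ^ r ≠ 0 := pow_ne_zero _ hy
    have hordr : ∀ R : Place k L, R.ord (y ^ r) = r * R.ord y := fun R => R.ord_pow y r
    have hr1 : (1 : ℤ) ≤ r := by rw [hr]; push_cast; linarith [Finset.sum_nonneg (s := S) (f := fun R : Place k L => |R.ord z|) (fun i _ => abs_nonneg _)]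
    have hQ's : z + y ^ r ≠ 0 ∧ Q'.ord (z + y ^ r) < 0 := by
      have h1 : Q'.ord (y ^ r) < 0 := by rw [hordr]; nlinarith
      obtain ⟨h2, h3⟩ := Q'.ord_add_of_lt hyr hz (by omega)
      rw [add_comm z]; exact ⟨h2, h3 ▸ h1⟩
    refine ⟨z + y ^ r, hQ's.1, ?_, ?_⟩
    · refine Int.lt_of_add_one_le ((Q.ge_iff hQ's.1).1 (Ge.add ?_ ?_))
      · rw [Q.ge_iff hz]; omega
      · rw [Q.ge_iff hyr, hordr]; nlinarith
    · intro R hR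
      rcases Finset.mem_insert.1 hR with rfl | hR
      · exact hQ's.2
      have hzR := hzS R hR
      have habs : |R.ord z| < r := by
        have := Finset.single_le_sum (f := fun R : Place k L => (R.ord z).natAbs)
          (fun _ _ => Nat.zero_le _) hR
        rw [Int.abs_eq_natAbs]; exact_mod_cast (by omega : (R.ord z).natAbs < r)
      rcases lt_trichotomy (R.ord z) (R.ord (y ^ r)) with h | h | h
      · rw [(R.ord_add_of_lt hz hyr h).2]; exact hzR
      · exfalso
        rw [hordr] at h
        rw [abs_lt] at habs
        have : R.ord y < 0 := by nlinarith
        nlinarith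
      · rw [add_comm, (R.ord_add_of_lt hyr hz h).2]; omega

/-- The function `1 / (1 + z ^ N)` is close to `1` at a zero of `z` and close to `0` at its poles.
-/
theorem exists_approx_one (Q : Place k L) (S : Finset (Place k L)) (hQ : Q ∉ S) (M : ℕ) :
    ∃ y : L, Q.Ge (y - 1) M ∧ ∀ Q' ∈ S, Q'.Ge y M := by
  obtain ⟨z, hz, hzQ, hzS⟩ := Q.exists_pos_forall_neg S hQ
  set N := M + 1
  have hzN : z ^ N ≠ 0 := pow_ne_zero _ hz
  have h1 : 1 + z ^ N ≠ 0 ∧ Q.ord (1 + z ^ N) = 0 := by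
    have := Q.ord_add_of_lt one_ne_zero hzN (by rw [ord_one, ord_pow]; positivity)
    rwa [ord_one] at this
  refine ⟨(1 + z ^ N)⁻¹, ?_, fun Q' hQ' => ?_⟩
  · have : (1 + z ^ N)⁻¹ - 1 = -(z ^ N * (1 + z ^ N)⁻¹) := by
      field_simp [h1.1]; ring
    rw [this]
    refine Ge.neg ?_
    rw [Q.ge_iff (mul_ne_zero hzN (inv_ne_zero h1.1)), ord_mul _ hzN (inv_ne_zero h1.1), ord_inv,
      h1.2, ord_pow]
    push_cast [N]; nlinarith
  · have h2 := Q'.ord_add_of_lt hzN one_ne_zero (by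
      rw [ord_one, ord_pow]; exact mul_neg_of_pos_of_neg (by positivity) (hzS Q' hQ'))
    rw [Q'.ge_iff (inv_ne_zero h1.1), ord_inv, add_comm, h2.2, ord_pow]
    push_cast [N]; nlinarith [hzS Q' hQ']

/-- Weak approximation. -/
theorem exists_approx (S : Finset (Place k L)) (y : Place k L → L) (M : ℤ) :
    ∃ f : L, ∀ Q ∈ S, Q.Ge (f - y Q) M := by
  classical
  set N : ℕ := M.toNat + ∑ Q ∈ S, ∑ Q' ∈ S, (Q'.ord (y Q)).natAbs with hN
  have hNle : ∀ Q ∈ S, ∀ Q' ∈ S, M ≤ N + Q'.ord (y Q) := by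
    intro Q hQ Q' hQ'
    have h1 := Finset.single_le_sum (f := fun Q' : Place k L => (Q'.ord (y Q)).natAbs)
      (fun _ _ => Nat.zero_le _) hQ'
    have h2 := Finset.single_le_sum
      (f := fun Q : Place k L => ∑ Q' ∈ S, (Q'.ord (y Q)).natAbs)
      (fun _ _ => Nat.zero_le _) hQ
    omega
  choose z hz1 hz2 using fun Q : Place k L =>
    Q.exists_approx_one (S.erase Q) (Finset.notMem_erase _ _) N
  refine ⟨∑ Q ∈ S, z Q * y Q, fun Q hQ => ?_⟩
  rw [← Finset.add_sum_erase S _ hQ, add_sub_right_comm]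
  refine Ge.add ?_ (Ge.sum fun Q' hQ' => ?_)
  · rw [show z Q * y Q - y Q = (z Q - 1) * y Q by ring]
    exact ((hz1 Q).mul (Q.ge_ord (y Q))).mono (hNle Q hQ Q hQ)
  · rw [Finset.mem_erase] at hQ'
    exact ((hz2 Q' Q (Finset.mem_erase.2 ⟨hQ'.1.symm, hQ⟩)).mul (Q.ge_ord (y Q'))).mono
      (hNle Q' hQ'.2 Q hQ)

theorem transcendental_of_ord_ne_zero (Q : Place k L) {f : L} (hf : Q.ord f ≠ 0) :
    Transcendental k f := by
  have hpos : ∀ g : L, 0 < Q.ord g → Transcendental k g := by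
    intro g hg halg
    have hg0 : g ≠ 0 := by rintro rfl; simp at hg
    have hi : g⁻¹ ∈ Algebra.adjoin k {g} := halg.isIntegral.inv_mem_adjoin
    have hmem : ∀ h ∈ Algebra.adjoin k {g}, Q.Ge h 0 := fun h hh => by
      induction hh using Algebra.adjoin_induction with
      | mem x hx =>
        rw [Set.mem_singleton_iff.1 hx, Q.ge_iff hg0]; exact hg.le
      | algebraMap r => exact Q.ge_algebraMap r
      | add x y _ _ hx hy => exact hx.add hy
      | mul x y _ _ hx hy => simpa using hx.mul hy
    have := (Q.ge_iff (inv_ne_zero hg0)).1 (hmem _ hi)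
    rw [ord_inv] at this; omega
  rcases lt_or_gt_of_ne hf with h | h
  · intro halg
    exact hpos f⁻¹ (by rw [ord_inv]; omega) halg.inv
  · exact hpos f h

/-- The functions of order at least `c Q` at the places `Q` of `S`. -/
def geOn (S : Finset (Place k L)) (c : Place k L → ℤ) : Submodule k L :=
  ⨅ Q ∈ S, Q.geSub (c Q)

theorem mem_geOn {S : Finset (Place k L)} {c : Place k L → ℤ} {f : L} :
    f ∈ geOn S c ↔ ∀ Q ∈ S, Q.Ge f (c Q) := by
  simp [geOn, mem_geSub]

/-- The space `F` represents the functions regular on `S` modulo those of order at least `c`. For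
`c` the orders of zeros of `t`, a basis of `F` is independent modulo `t`, so its dimension, the
number of zeros, is bounded by `[L : k(t)]`. -/
theorem exists_complement (S : Finset (Place k L))
    (hfin : ∀ Q ∈ S, FiniteDimensional k (IsLocalRing.ResidueField Q.ring)) (N : ℕ) :
    ∀ c : Place k L → ℕ, ∑ Q ∈ S, c Q = N →
      ∃ F : Submodule k L, FiniteDimensional k F ∧ F ≤ geOn S 0 ∧
        F ⊓ geOn S (fun Q => c Q) = ⊥ ∧ Module.finrank k F = ∑ Q ∈ S, c Q * Q.deg := by
  classical
  induction N with
  | zero =>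
    intro c hc
    refine ⟨⊥, inferInstance, bot_le, bot_inf_eq _, ?_⟩
    rw [finrank_bot, eq_comm]
    exact Finset.sum_eq_zero fun Q hQ => by rw [Finset.sum_eq_zero_iff.1 hc Q hQ, zero_mul]
  | succ N ih =>
    intro c hc
    obtain ⟨Q, hQ, hcQ⟩ : ∃ Q ∈ S, c Q ≠ 0 := by
      by_contra! h
      rw [Finset.sum_eq_zero h] at hc; omega
    have := hfin Q hQ
    set c' := Function.update c Q (c Q - 1) with hc'
    have hc'Q : c' Q = c Q - 1 := by simp [hc']
    have hc'ne : ∀ R, R ≠ Q → c' R = c R := fun R hR => by simp [hc', hR]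
    have hsum : ∀ d : Place k L → ℕ, ∑ R ∈ S, c R * d R = ∑ R ∈ S, c' R * d R + d Q := by
      intro d
      rw [← Finset.add_sum_erase S _ hQ, ← Finset.add_sum_erase S (fun R => c' R * d R) hQ, hc'Q,
        Finset.sum_congr rfl fun R hR => by rw [← hc'ne R (Finset.ne_of_mem_erase hR)]]
      obtain ⟨a, ha⟩ := Nat.exists_eq_succ_of_ne_zero hcQ
      rw [ha]; simp; ring
    obtain ⟨F, hF, hF0, hFc, hFr⟩ := ih c' (by
      have := hsum (fun _ => 1); simp only [mul_one] at this; omega)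
    have hle : geOn S (fun R => c' R) ≤ Q.geSub (c' Q) := fun f hf => mem_geOn.1 hf Q hQ
    have hsurj : Function.Surjective (Q.leadOn hle) := by
      intro a
      obtain ⟨y, hy⟩ := Q.lead_surjective (c' Q) a
      obtain ⟨f, hf⟩ := exists_approx S (Function.update 0 Q (y : L)) (∑ R ∈ S, c R : ℕ)
      have hle' : ∀ R ∈ S, (c R : ℤ) ≤ (∑ R ∈ S, c R : ℕ) := fun R hR => by
        exact_mod_cast Finset.single_le_sum (fun _ _ => Nat.zero_le _) hR
      have hfQ : Q.Ge (f - y) (c' Q + 1) := by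
        have := (hf Q hQ).mono (hle' Q hQ)
        rw [Function.update_self] at this
        exact this.mono (by omega)
      refine ⟨⟨f, mem_geOn.2 fun R hR => ?_⟩, ?_⟩
      · by_cases hRQ : R = Q
        · subst hRQ
          have := (hfQ.mono (by omega : ((c' R : ℕ) : ℤ) ≤ c' R + 1)).add (mem_geSub.1 y.2)
          simpa using this
        · have := (hf R hR).mono (hle' R hR)
          simp only [Function.update_of_ne hRQ, Pi.zero_apply, sub_zero] at this
          rw [hc'ne R hRQ]; exact this
      · exact ((Q.lead_eq_iff _ _ _).2 hfQ).trans hy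
    -- A section of the leading coefficient at `Q` supplies the `deg Q` missing dimensions.
    obtain ⟨s, hs⟩ := LinearMap.exists_rightInverse_of_surjective (Q.leadOn hle)
      (LinearMap.range_eq_top.2 hsurj)
    have hs' : ∀ a, Q.leadOn hle (s a) = a := fun a => LinearMap.congr_fun hs a
    set g := (geOn S (fun R => c' R)).subtype ∘ₗ s with hg
    have hginj : Function.Injective g :=
      Subtype.val_injective.comp (Function.LeftInverse.injective hs')
    set G := LinearMap.range g with hG
    have hGle : G ≤ geOn S (fun R => c' R) := by
      rintro _ ⟨a, rfl⟩; exact (s a).2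
    have hle0 : geOn S (fun R => (c' R : ℤ)) ≤ geOn S 0 := fun f hf =>
      mem_geOn.2 fun R hR => (mem_geOn.1 hf R hR).mono (by simp)
    have hlec : geOn S (fun R => (c R : ℤ)) ≤ geOn S (fun R => c' R) := fun f hf =>
      mem_geOn.2 fun R hR => (mem_geOn.1 hf R hR).mono (by
        by_cases hRQ : R = Q
        · subst hRQ; omega
        · rw [hc'ne R hRQ])
    have hFG : F ⊓ G = ⊥ := by
      rw [eq_bot_iff, ← hFc]; exact inf_le_inf_left _ hGle
    refine ⟨F ⊔ G, inferInstance, sup_le hF0 (hGle.trans hle0), ?_, ?_⟩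
    · rw [eq_bot_iff]
      rintro x ⟨hx, hxc⟩
      obtain ⟨f, hf, _, ⟨a, rfl⟩, rfl⟩ := Submodule.mem_sup.1 hx
      have hf0 : f = 0 := by
        have h1 : f ∈ F ⊓ geOn S (fun R => (c' R : ℤ)) := by
          refine ⟨hf, ?_⟩
          have := Submodule.sub_mem _ (hlec hxc) (hGle ⟨a, rfl⟩)
          simpa using this
        rw [hFc] at h1; simpa using h1
      rw [hf0, zero_add] at hxc ⊢
      have h2 : Q.Ge (g a) (c' Q + 1) := (mem_geOn.1 hxc Q hQ).mono (by omega)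
      have h3 : Q.leadOn hle (s a) = 0 := (Q.lead_eq_zero_iff _ _).2 h2
      rw [hs'] at h3
      rw [h3]; simp
    · have := Submodule.finrank_sup_add_finrank_inf_eq F G
      rw [hFG, finrank_bot, add_zero, LinearMap.finrank_range_of_inj hginj] at this
      rw [this, hFr, hsum, deg]

end Place

namespace IsFunctionField

variable (hL : IsFunctionField k L)
include hL

theorem finiteDimensional_residueField (Q : Place k L) :
    FiniteDimensional k (IsLocalRing.ResidueField Q.ring) := by
  have ht : Transcendental k Q.localParam :=
    Q.transcendental_of_ord_ne_zero (by rw [Q.ord_localParam]; norm_num)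
  have h1 : Q.Ge Q.localParam 1 := by
    have := Q.ge_ord Q.localParam; rwa [Q.ord_localParam] at this
  refine Module.rank_lt_aleph0_iff.1 (lt_of_le_of_lt (rank_le
    (n := Module.finrank (IntermediateField.adjoin k {Q.localParam}) L) fun s hs => ?_)
    Cardinal.natCast_lt_aleph0)
  -- Lifts of independent residues are independent modulo the local parameter, hence over the field
  -- it generates.
  choose r hr using fun i : s => Q.lead_surjective 0 (i : IsLocalRing.ResidueField Q.ring)
  have := hL.card_le_finrank ht (M := Q.geSub 0) (v := fun i => (r i : L))
    (fun f hf => (h1.mul hf).mono (by norm_num)) (fun i => (r i).2) (by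
      rintro c ⟨f, hf, hcf⟩
      rw [Fintype.linearIndependent_iff] at hs
      refine hs c ?_
      have h2 : Q.lead 0 (∑ i, c i • r i) = 0 := by
        rw [Q.lead_eq_zero_iff]
        have h3 : ((∑ i, c i • r i : Q.geSub 0) : L) = Q.localParam * f := by
          rw [← hcf]; simp
        rw [h3]
        exact (h1.mul hf).mono (by norm_num)
      rw [map_sum] at h2
      rw [← h2]
      exact Finset.sum_congr rfl fun i _ => by rw [map_smul, hr])
  simpa using this

theorem deg_pos (Q : Place k L) : 0 < Q.deg := by
  have := hL.finiteDimensional_residueField Q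
  exact Module.finrank_pos

/-- The degree of the divisor of zeros of `t` is at most `[L : k(t)]`. -/
theorem sum_zeros_le {t : L} (ht : Transcendental k t) (S : Finset (Place k L))
    (hS : ∀ Q ∈ S, 0 ≤ Q.ord t) :
    ∑ Q ∈ S, Q.ord t * Q.deg ≤ Module.finrank (IntermediateField.adjoin k {t}) L := by
  have ht0 : t ≠ 0 := fun h => ht (by rw [h]; exact isAlgebraic_zero)
  obtain ⟨F, hF, hF0, hFc, hFr⟩ := Place.exists_complement S
    (fun Q _ => hL.finiteDimensional_residueField Q) _ (fun Q => (Q.ord t).toNat) rfl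
  have h1 : ∑ Q ∈ S, Q.ord t * Q.deg = (Module.finrank k F : ℕ) := by
    rw [hFr]; push_cast
    exact Finset.sum_congr rfl fun Q hQ => by rw [Int.toNat_of_nonneg (hS Q hQ)]
  rw [h1, Nat.cast_le]
  let b := Module.finBasis k F
  have := hL.card_le_finrank ht (M := Place.geOn S 0) (v := fun i => (b i : L))
    (fun f hf => Place.mem_geOn.2 fun Q hQ => by
      have := ((Q.ge_iff ht0).2 (hS Q hQ)).mul (Place.mem_geOn.1 hf Q hQ)
      simpa using this)
    (fun i => hF0 (b i).2) (by
      rintro c ⟨f, hf, hcf⟩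
      have hmem : ((∑ i, c i • b i : F) : L) ∈ F ⊓ Place.geOn S (fun Q => ((Q.ord t).toNat : ℤ)) := by
        refine ⟨(∑ i, c i • b i : F).2, Place.mem_geOn.2 fun Q hQ => ?_⟩
        have h2 : ((∑ i, c i • b i : F) : L) = t * f := by rw [← hcf]; simp
        rw [h2, Int.toNat_of_nonneg (hS Q hQ)]
        have := (Q.ge_ord t).mul (Place.mem_geOn.1 hf Q hQ)
        simpa using this
      rw [hFc, Submodule.mem_bot, ZeroMemClass.coe_eq_zero] at hmem
      exact Fintype.linearIndependent_iff.1 b.linearIndependent c hmem)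
  simpa using this

theorem finite_zeros (f : L) : {Q : Place k L | 0 < Q.ord f}.Finite := by
  by_contra hinf
  obtain ⟨Q, hQ⟩ := Set.Infinite.nonempty hinf
  have ht := Q.transcendental_of_ord_ne_zero (ne_of_gt hQ)
  obtain ⟨S, hS, hcard⟩ := Set.Infinite.exists_subset_card_eq hinf
    (Module.finrank (IntermediateField.adjoin k {f}) L + 1)
  have h1 := hL.sum_zeros_le ht S (fun Q hQ => le_of_lt (hS hQ))
  have h2 : ∑ Q ∈ S, (1 : ℤ) ≤ ∑ Q ∈ S, Q.ord f * Q.deg := Finset.sum_le_sum fun Q hQ => by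
    have h3 : 0 < Q.ord f := hS hQ
    have h4 := hL.deg_pos Q
    have : (1 : ℤ) ≤ Q.deg := by exact_mod_cast h4
    nlinarith
  simp only [Finset.sum_const, hcard, nsmul_eq_mul, mul_one] at h2
  push_cast at h2; omega

theorem finite_poles (f : L) : {Q : Place k L | Q.ord f < 0}.Finite := by
  refine (hL.finite_zeros f⁻¹).subset fun Q (hQ : Q.ord f < 0) => ?_
  change 0 < Q.ord f⁻¹
  rw [Q.ord_inv]; omega

theorem finite_support (f : L) : {Q : Place k L | Q.ord f ≠ 0}.Finite :=
  ((hL.finite_zeros f).union (hL.finite_poles f)).subset fun Q (hQ : Q.ord f ≠ 0) => by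
    rcases lt_or_gt_of_ne hQ with h | h
    · exact Or.inr h
    · exact Or.inl h

end IsFunctionField

end

/-! ### Riemann–Roch spaces, Riemann's theorem and strong approximation. -/

section

variable {k : Type u} {L : Type v} [Field k] [Field L] [Algebra k L]

theorem mem_rrSpace {D : Place k L →₀ ℤ} {f : L} :
    f ∈ rrSpace k L D ↔ ∀ Q : Place k L, Q.Ge f (-D Q) := by
  simp only [Place.Ge, neg_neg]; rfl

theorem rrSpace_mono {D D' : Place k L →₀ ℤ} (h : D ≤ D') : rrSpace k L D ≤ rrSpace k L D' :=
  fun _ hf => mem_rrSpace.2 fun Q => (mem_rrSpace.1 hf Q).mono (neg_le_neg (h Q))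

theorem divDeg_add (D E : Place k L →₀ ℤ) : divDeg k L (D + E) = divDeg k L D + divDeg k L E :=
  Finsupp.sum_add_index' (by simp) (by intros; ring)

theorem divDeg_zero : divDeg k L 0 = 0 := Finsupp.sum_zero_index

theorem divDeg_neg (D : Place k L →₀ ℤ) : divDeg k L (-D) = -divDeg k L D := by
  have := divDeg_add D (-D)
  rw [add_neg_cancel, divDeg_zero] at this; omega

theorem divDeg_sub (D E : Place k L →₀ ℤ) : divDeg k L (D - E) = divDeg k L D - divDeg k L E := by
  rw [sub_eq_add_neg, divDeg_add, divDeg_neg]; rfl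

theorem divDeg_nsmul (n : ℕ) (D : Place k L →₀ ℤ) : divDeg k L (n • D) = n * divDeg k L D := by
  induction n with
  | zero => simp [divDeg_zero]
  | succ n ih => rw [succ_nsmul, divDeg_add, ih]; push_cast; ring

theorem divDeg_single (Q : Place k L) (n : ℤ) :
    divDeg k L (Finsupp.single Q n) = n * Q.deg := by
  simp [divDeg]

theorem divisor_induction {C : (Place k L →₀ ℤ) → Prop} {D : Place k L →₀ ℤ} (h0 : C D)
    (hstep : ∀ (D' : Place k L →₀ ℤ) (Q : Place k L), D ≤ D' → C D' → C (D' + Finsupp.single Q 1)) :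
    ∀ D', D ≤ D' → C D' := by
  classical
  have key : ∀ (n : ℕ) (D' : Place k L →₀ ℤ), D ≤ D' → (D' - D).sum (fun _ a => a) = n → C D' := by
    intro n
    induction n with
    | zero =>
      intro D' hD hn
      have : D' = D := by
        have h1 := (Finset.sum_eq_zero_iff_of_nonneg (fun Q _ => by
          have := hD Q; simp only [Finsupp.coe_sub, Pi.sub_apply]; omega)).1 hn
        ext Q
        by_cases hQ : Q ∈ (D' - D).support
        · have := h1 Q hQ; simp at this; omega
        · rw [Finsupp.notMem_support_iff] at hQ; simp at hQ; omega
      exact this ▸ h0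
    | succ n ih =>
      intro D' hD hn
      obtain ⟨Q, hQ⟩ : ∃ Q, (D' - D) Q ≠ 0 := by
        by_contra! h
        have : D' - D = 0 := Finsupp.ext h
        rw [this, Finsupp.sum_zero_index] at hn
        push_cast at hn; omega
      have hQ' : D Q < D' Q := lt_of_le_of_ne (hD Q) (by
        intro h; simp [h] at hQ)
      have hle : D ≤ D' - Finsupp.single Q 1 := by
        intro R
        by_cases hR : R = Q
        · subst hR; simp; omega
        · have := hD R
          simpa [Ne.symm hR] using this
      have := hstep _ Q hle (ih _ hle (by
        have h2 : D' - D = (D' - Finsupp.single Q 1 - D) + Finsupp.single Q 1 := by abel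
        rw [h2, Finsupp.sum_add_index' (by simp) (by simp), Finsupp.sum_single_index rfl] at hn
        push_cast at hn; omega))
      simpa using this
  intro D' hD
  refine key ((D' - D).sum (fun _ a => a)).toNat D' hD ?_
  rw [Int.toNat_of_nonneg]
  exact Finset.sum_nonneg fun Q _ => by
    have := hD Q; simp only [Finsupp.coe_sub, Pi.sub_apply]; omega

theorem mem_rrSpace_iff_step (D : Place k L →₀ ℤ) (Q : Place k L) (f : L) :
    f ∈ rrSpace k L D ↔ f ∈ rrSpace k L (D + Finsupp.single Q 1) ∧
      Q.Ge f (-(D + Finsupp.single Q 1 : Place k L →₀ ℤ) Q + 1) := by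
  classical
  simp only [mem_rrSpace]
  constructor
  · intro h
    refine ⟨fun R => (h R).mono ?_, (h Q).mono ?_⟩
    · by_cases hR : Q = R <;> simp [hR]
    · simp
  · rintro ⟨h1, h2⟩ R
    by_cases hR : Q = R
    · subst hR; exact h2.mono (by simp)
    · have := h1 R
      simpa [Finsupp.single_apply, hR] using this

theorem rrSpace_le_geSub (D : Place k L →₀ ℤ) (Q : Place k L) :
    rrSpace k L D ≤ Q.geSub (-D Q) := fun _ hf => mem_rrSpace.1 hf Q

/-- The divisor of a function (`0` for the zero function). -/
def IsFunctionField.principal (hL : IsFunctionField k L) (f : L) : Place k L →₀ ℤ :=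
  Finsupp.ofSupportFinite (fun Q => Q.ord f) (hL.finite_support f)

/-- The divisor of poles of a function. -/
def IsFunctionField.polar (hL : IsFunctionField k L) (f : L) : Place k L →₀ ℤ :=
  (hL.principal f).mapRange (fun n => max (-n) 0) (by simp)

namespace IsFunctionField

section

variable (hL : IsFunctionField k L)

@[simp] theorem principal_apply (f : L) (Q : Place k L) : hL.principal f Q = Q.ord f := rfl

@[simp] theorem polar_apply (f : L) (Q : Place k L) : hL.polar f Q = max (-Q.ord f) 0 := rfl

theorem principal_eq (f : L) : hL.principal f = hL.polar f⁻¹ - hL.polar f := by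
  ext Q; simp [Q.ord_inv]

theorem principal_inv (f : L) : hL.principal f⁻¹ = -hL.principal f := by
  ext Q; simp [Q.ord_inv]

theorem divDeg_polar_inv_le {t : L} (ht : Transcendental k t) :
    divDeg k L (hL.polar t⁻¹) ≤ Module.finrank (IntermediateField.adjoin k {t}) L := by
  classical
  have hS : ∀ Q ∈ (hL.polar t⁻¹).support, 0 < Q.ord t := fun Q hQ => by
    rw [Finsupp.mem_support_iff, polar_apply, Q.ord_inv, neg_neg] at hQ
    by_contra! h; exact hQ (max_eq_right h)
  refine le_trans (le_of_eq ?_) (hL.sum_zeros_le ht (hL.polar t⁻¹).support fun Q hQ => (hS Q hQ).le)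
  refine Finset.sum_congr rfl fun Q hQ => ?_
  rw [polar_apply, Q.ord_inv, neg_neg, max_eq_left (hS Q hQ).le]

variable {P : Place k L} (hP : P.deg = 1)
include hL hP

/-- An element of this space has no pole; if it vanished at `P` without being zero it would be
transcendental and have one. So evaluation at `P` embeds the space in a residue field of dimension
one. -/
theorem finiteDimensional_rrSpace_of_le_zero {D : Place k L →₀ ℤ} (hD : D ≤ 0) :
    FiniteDimensional k (rrSpace k L D) ∧ Module.finrank k (rrSpace k L D) ≤ 1 := by
  have := hL.finiteDimensional_residueField P
  have hN : rrSpace k L D ≤ P.geSub 0 := fun f hf => by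
    have h1 := mem_rrSpace.1 hf P
    exact h1.mono (by have := hD P; simp at this; omega)
  have hbot : ∀ f, f ∈ (⊥ : Submodule k L) ↔ f ∈ rrSpace k L D ∧ P.Ge f (0 + 1) := by
    intro f
    constructor
    · intro hf
      rw [(Submodule.mem_bot k).1 hf]
      exact ⟨Submodule.zero_mem _, P.ge_zero _⟩
    · rintro ⟨hf, hfP⟩
      by_contra hf0
      rw [Submodule.mem_bot] at hf0
      rw [P.ge_iff hf0] at hfP
      obtain ⟨Q, hQ⟩ := hL.exists_pole (P.transcendental_of_ord_ne_zero (by omega : P.ord f ≠ 0))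
      refine hQ ((mem_rrSpace.1 hf Q).mono ?_)
      have := hD Q; simp at this; omega
  have hfin := P.finiteDimensional_of_step hN hbot
  refine ⟨hfin, ?_⟩
  have := P.finrank_step_le hN hbot
  rwa [hP, finrank_bot, zero_add] at this

theorem finiteDimensional_rrSpace (D : Place k L →₀ ℤ) : FiniteDimensional k (rrSpace k L D) := by
  have h : ∀ D', D ⊓ 0 ≤ D' → FiniteDimensional k (rrSpace k L D') := by
    refine divisor_induction (hL.finiteDimensional_rrSpace_of_le_zero hP inf_le_right).1 ?_
    intro D' Q _ hD'
    have := hL.finiteDimensional_residueField Q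
    exact Q.finiteDimensional_of_step (rrSpace_le_geSub _ Q) (mem_rrSpace_iff_step D' Q)
  exact h D inf_le_left

theorem rrDim_zero_le : rrDim k L 0 ≤ 1 := (hL.finiteDimensional_rrSpace_of_le_zero hP le_rfl).2

theorem rrDim_add_single_le (D : Place k L →₀ ℤ) (Q : Place k L) :
    rrDim k L (D + Finsupp.single Q 1) ≤ rrDim k L D + Q.deg := by
  have := hL.finiteDimensional_residueField Q
  have := hL.finiteDimensional_rrSpace hP (D + Finsupp.single Q 1)
  exact Q.finrank_step_le (rrSpace_le_geSub _ Q) (mem_rrSpace_iff_step D Q)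

theorem divDeg_sub_rrDim_mono {D D' : Place k L →₀ ℤ} (h : D ≤ D') :
    divDeg k L D - rrDim k L D ≤ divDeg k L D' - rrDim k L D' := by
  refine divisor_induction (C := fun D' => divDeg k L D - rrDim k L D ≤
    divDeg k L D' - rrDim k L D') le_rfl (fun D' Q _ hD' => ?_) D' h
  have h1 := hL.rrDim_add_single_le hP D' Q
  rw [divDeg_add, divDeg_single]
  omega

omit hP in
theorem rrDim_add_principal (D : Place k L →₀ ℤ) {f : L} (hf : f ≠ 0) :
    rrDim k L (D + hL.principal f) = rrDim k L D := by
  refine LinearEquiv.finrank_eq (LinearEquiv.ofLinearMap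
    (LinearMap.restrict (LinearMap.mulLeft k f) fun g hg => ?_)
    (LinearMap.restrict (LinearMap.mulLeft k f⁻¹) fun g hg => ?_) ?_ ?_)
  · rw [mem_rrSpace] at hg ⊢
    intro Q
    exact ((Q.ge_ord f).mul (hg Q)).mono (by simp)
  · rw [mem_rrSpace] at hg ⊢
    intro Q
    exact ((Q.ge_ord f⁻¹).mul (hg Q)).mono (by simp [Q.ord_inv])
  · ext g; simp [hf]
  · ext g; simp [hf]

/-- The growth of the spaces `L(m (t)_∞ + E)`. -/
theorem exists_growth {t : L} (ht : Transcendental k t) : ∃ E : Place k L →₀ ℤ, 0 ≤ E ∧ ∀ m : ℕ,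
    (Module.finrank (IntermediateField.adjoin k {t}) L : ℤ) * (m + 1) ≤
      rrDim k L (m • hL.polar t + E) := by
  classical
  have := hL.finiteDimensional ht
  have ht0 : t ≠ 0 := fun h => ht (by rw [h]; exact isAlgebraic_zero)
  let b := Module.finBasis (IntermediateField.adjoin k {t}) L
  -- `E` absorbs the poles of a basis `b i` of `L` over `k(t)`. The products `t ^ j * b i` with `j ≤
  -- m` are independent over `k` and lie in the space.
  refine ⟨∑ i, hL.polar (b i), Finset.sum_nonneg fun i _ Q => by simp, fun m => ?_⟩
  have hpow : LinearIndependent k (fun j : Fin (m + 1) =>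
      (IntermediateField.AdjoinSimple.gen k t) ^ (j : ℕ)) := by
    have htr : Transcendental k (IntermediateField.AdjoinSimple.gen k t) := by
      intro h
      have := h.algebraMap (A := L)
      rw [IntermediateField.AdjoinSimple.algebraMap_gen] at this
      exact ht this
    have h1 := (Polynomial.basisMonomials k).linearIndependent.map'
      (Polynomial.aeval (IntermediateField.AdjoinSimple.gen k t)).toLinearMap
      (LinearMap.ker_eq_bot.2 (transcendental_iff_injective.1 htr))
    have h2 := h1.comp (fun j : Fin (m + 1) => (j : ℕ)) Fin.val_injective
    have heq : (((Polynomial.aeval (IntermediateField.AdjoinSimple.gen k t)).toLinearMap ∘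
        (Polynomial.basisMonomials k)) ∘ fun j : Fin (m + 1) => (j : ℕ)) =
        fun j : Fin (m + 1) => (IntermediateField.AdjoinSimple.gen k t) ^ (j : ℕ) := by
      funext j; simp
    rw [heq] at h2
    exact h2
  have hli := linearIndependent_smul hpow b.linearIndependent
  have hmem : ∀ x : Fin (m + 1) × Fin (Module.finrank (IntermediateField.adjoin k {t}) L),
      (IntermediateField.AdjoinSimple.gen k t) ^ (x.1 : ℕ) • b x.2 ∈
        rrSpace k L (m • hL.polar t + ∑ i, hL.polar (b i)) := by
    intro x
    rw [mem_rrSpace]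
    intro Q
    have h2 : (IntermediateField.AdjoinSimple.gen k t) ^ (x.1 : ℕ) • b x.2 =
        t ^ (x.1 : ℕ) * b x.2 := rfl
    rw [h2]
    refine (((Q.ge_ord t).pow x.1).mul (Q.ge_ord (b x.2))).mono ?_
    have h3 : max (-Q.ord (b x.2)) 0 ≤ ∑ i, max (-Q.ord (b i)) 0 :=
      Finset.single_le_sum (f := fun i => max (-Q.ord (b i)) 0)
        (fun i _ => le_max_right _ _) (Finset.mem_univ x.2)
    have h4 : -(((x.1 : ℕ) : ℤ) * Q.ord t) ≤ m * max (-Q.ord t) 0 := by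
      have h5 : ((x.1 : ℕ) : ℤ) ≤ m := by have := x.1.2; omega
      calc -(((x.1 : ℕ) : ℤ) * Q.ord t) = (x.1 : ℕ) * (-Q.ord t) := by ring
        _ ≤ (x.1 : ℕ) * max (-Q.ord t) 0 := mul_le_mul_of_nonneg_left (le_max_left _ _) (by simp)
        _ ≤ m * max (-Q.ord t) 0 := mul_le_mul_of_nonneg_right h5 (le_max_right _ _)
    have h6 : (m • hL.polar t + ∑ i, hL.polar (b i)) Q =
        m * max (-Q.ord t) 0 + ∑ i, max (-Q.ord (b i)) 0 := by
      simp
    rw [h6]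
    have := le_max_left (-Q.ord (b x.2)) 0
    linarith
  have := hL.finiteDimensional_rrSpace hP (m • hL.polar t + ∑ i, hL.polar (b i))
  have h7 := (LinearIndependent.of_comp (rrSpace k L _).subtype
    (v := fun x => (⟨_, hmem x⟩ : rrSpace k L _)) hli).fintype_card_le_finrank
  rw [Fintype.card_prod, Fintype.card_fin, Fintype.card_fin] at h7
  have h8 : (((m + 1) * Module.finrank (IntermediateField.adjoin k {t}) L : ℕ) : ℤ) ≤
    rrDim k L (m • hL.polar t + ∑ i, hL.polar (b i)) := Nat.cast_le.2 h7
  push_cast at h8; linarith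

theorem rrDim_le {D : Place k L →₀ ℤ} (hD : 0 ≤ D) : (rrDim k L D : ℤ) ≤ divDeg k L D + 1 := by
  have h1 := hL.divDeg_sub_rrDim_mono hP hD
  have h2 := hL.rrDim_zero_le hP
  rw [divDeg_zero] at h1; omega

omit hP in
theorem polar_nonneg (f : L) : 0 ≤ hL.polar f := fun Q => by simp

/-- The growth of `ℓ(m (t)_∞ + E)` is compared with the bound `ℓ ≤ deg + 1` for large `m`. -/
theorem finrank_le_divDeg_polar {t : L} (ht : Transcendental k t) :
    (Module.finrank (IntermediateField.adjoin k {t}) L : ℤ) ≤ divDeg k L (hL.polar t) := by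
  obtain ⟨E, hE, h⟩ := hL.exists_growth hP ht
  by_contra! hlt
  set n : ℤ := (Module.finrank (IntermediateField.adjoin k {t}) L : ℤ)
  set d := divDeg k L (hL.polar t)
  have h1 := fun m : ℕ => (h m).trans (hL.rrDim_le hP
    (add_nonneg (nsmul_nonneg (hL.polar_nonneg t) m) hE))
  simp only [divDeg_add, divDeg_nsmul] at h1
  have h2 := h1 (divDeg k L E + 1).toNat
  have h3 := Int.self_le_toNat (divDeg k L E + 1)
  set m : ℤ := ((divDeg k L E + 1).toNat : ℤ)
  have hn : 0 ≤ n := Int.natCast_nonneg _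
  have hm : 0 ≤ m := Int.natCast_nonneg _
  have h4 : m * d ≤ m * (n - 1) := mul_le_mul_of_nonneg_left (by omega) hm
  have h5 : 0 < n := by
    have := hL.finiteDimensional ht
    exact Int.natCast_pos.2 Module.finrank_pos
  nlinarith

/-- The number of zeros is at most `[L : k(g)]`, which is at most the number of poles. This is
applied to `f` and to `f⁻¹`. -/
theorem divDeg_principal (f : L) : divDeg k L (hL.principal f) = 0 := by
  have key : ∀ g : L, Transcendental k g → divDeg k L (hL.principal g) ≤ 0 := by
    intro g hg
    rw [principal_eq, divDeg_sub]
    have h1 := hL.divDeg_polar_inv_le hg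
    have h2 := hL.finrank_le_divDeg_polar hP hg
    omega
  by_cases hf : Transcendental k f
  · have hf' : Transcendental k f⁻¹ := fun h => hf (inv_inv f ▸ h.inv)
    have h1 := key f hf
    have h2 := key f⁻¹ hf'
    rw [principal_inv, divDeg_neg] at h2
    omega
  · have : hL.principal f = 0 := by
      ext Q
      by_contra h
      exact hf (Q.transcendental_of_ord_ne_zero h)
    rw [this, divDeg_zero]

theorem divDeg_polar_eq {t : L} (ht : Transcendental k t) :
    divDeg k L (hL.polar t) = Module.finrank (IntermediateField.adjoin k {t}) L := by
  have h1 := hL.divDeg_polar_inv_le ht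
  have h2 := hL.finrank_le_divDeg_polar hP ht
  have h3 := hL.divDeg_principal hP t
  rw [principal_eq, divDeg_sub] at h3
  omega

theorem rrDim_eq_zero_of_divDeg_neg {D : Place k L →₀ ℤ} (hD : divDeg k L D < 0) :
    rrDim k L D = 0 := by
  have : rrSpace k L D = ⊥ := by
    rw [eq_bot_iff]
    intro f hf
    by_contra hf0
    rw [Submodule.mem_bot] at hf0
    have h1 : 0 ≤ D + hL.principal f := fun Q => by
      have := (Q.ge_iff hf0).1 (mem_rrSpace.1 hf Q)
      simp; omega
    have h2 : 0 ≤ divDeg k L (D + hL.principal f) :=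
      Finset.sum_nonneg fun Q _ => mul_nonneg (h1 Q) (by simp)
    rw [divDeg_add, hL.divDeg_principal hP] at h2
    omega
  rw [rrDim, this, finrank_bot]

/-- Riemann's theorem. -/
theorem bddAbove_genus :
    BddAbove (Set.range fun D : Place k L →₀ ℤ => divDeg k L D - (rrDim k L D : ℤ) + 1) := by
  have ht : Transcendental k P.localParam :=
    P.transcendental_of_ord_ne_zero (by rw [P.ord_localParam]; norm_num)
  obtain ⟨E, hE, h⟩ := hL.exists_growth hP ht
  have h5 : (1 : ℤ) ≤ Module.finrank (IntermediateField.adjoin k {P.localParam}) L := by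
    have := hL.finiteDimensional ht
    exact Int.natCast_pos.2 Module.finrank_pos
  have hZ := hL.divDeg_polar_eq hP ht
  refine ⟨divDeg k L E + 1, ?_⟩
  rintro _ ⟨D, rfl⟩
  simp only
  set n : ℤ := (Module.finrank (IntermediateField.adjoin k {P.localParam}) L : ℤ)
  -- For this `m` the space `L(m (t)_∞ + E - D⁺)`, where `D⁺ = D ⊔ 0`, has a nonzero element `f`. Up
  -- to the divisor of `f`, `D` then lies below `m (t)_∞ + E`, for which the growth estimate bounds
  -- `deg - ℓ`.
  set m : ℕ := (divDeg k L (D ⊔ 0)).toNat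
  have hm : divDeg k L (D ⊔ 0) ≤ m := Int.self_le_toNat _
  have h1 := hL.divDeg_sub_rrDim_mono hP (D := m • hL.polar P.localParam + E - (D ⊔ 0))
    (D' := m • hL.polar P.localParam + E) (sub_le_self _ le_sup_right)
  rw [divDeg_sub] at h1
  have h2 := h m
  have h6 : 0 < rrDim k L (m • hL.polar P.localParam + E - (D ⊔ 0)) := by
    have hm0 : (0 : ℤ) ≤ m := Int.natCast_nonneg _
    have : (0 : ℤ) < rrDim k L (m • hL.polar P.localParam + E - (D ⊔ 0)) := by nlinarith
    exact_mod_cast this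
  have := Module.nontrivial_of_finrank_pos h6
  obtain ⟨⟨f, hf⟩, hf0⟩ := exists_ne (0 : rrSpace k L (m • hL.polar P.localParam + E - (D ⊔ 0)))
  have hf0' : f ≠ 0 := fun h => hf0 (Subtype.ext h)
  have hle : D ≤ m • hL.polar P.localParam + E + hL.principal f := by
    intro Q
    have h3 := (Q.ge_iff hf0').1 (mem_rrSpace.1 hf Q)
    have h4 : D Q ≤ (D ⊔ 0) Q := (le_sup_left : D ≤ D ⊔ 0) Q
    simp only [Finsupp.coe_sub, Finsupp.coe_add, Pi.sub_apply, Pi.add_apply, principal_apply]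
      at h3 ⊢
    linarith
  have h7 := hL.divDeg_sub_rrDim_mono hP hle
  rw [hL.rrDim_add_principal _ hf0', divDeg_add, hL.divDeg_principal hP, divDeg_add,
    divDeg_nsmul, hZ] at h7
  nlinarith

theorem le_genus (D : Place k L →₀ ℤ) :
    divDeg k L D - rrDim k L D + 1 ≤ genus k L :=
  le_ciSup (hL.bddAbove_genus hP) D

theorem exists_nonspecial : ∃ D : Place k L →₀ ℤ, divDeg k L D - rrDim k L D + 1 = genus k L :=
  Int.csSup_mem (Set.range_nonempty _) (hL.bddAbove_genus hP)

theorem nonspecial_mono {D D' : Place k L →₀ ℤ} (h : D ≤ D')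
    (hD : divDeg k L D - rrDim k L D + 1 = genus k L) :
    divDeg k L D' - rrDim k L D' + 1 = genus k L :=
  le_antisymm (hL.le_genus hP D') (by
    rw [← hD]; linarith [hL.divDeg_sub_rrDim_mono hP h])

/-- For large `n`, `nP - E` exceeds, up to a principal divisor, a divisor at which the genus is
attained, and the maximum persists for larger divisors. -/
theorem exists_nonspecial_sub (E : Place k L →₀ ℤ) : ∃ n₀ : ℕ, ∀ n : ℕ, n₀ ≤ n →
    divDeg k L (Finsupp.single P (n : ℤ) - E) - rrDim k L (Finsupp.single P (n : ℤ) - E) + 1 =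
      genus k L := by
  obtain ⟨D₀, hD₀⟩ := hL.exists_nonspecial hP
  set n₀ := (divDeg k L E + divDeg k L D₀ + genus k L).toNat
  have hn₀ := Int.self_le_toNat (divDeg k L E + divDeg k L D₀ + genus k L)
  refine ⟨n₀, fun n hn => ?_⟩
  have hn' : (n₀ : ℤ) ≤ n := by exact_mod_cast hn
  have h1 := hL.le_genus hP (Finsupp.single P (n : ℤ) - E - D₀)
  rw [divDeg_sub, divDeg_sub, divDeg_single, hP] at h1
  have h6 : 0 < rrDim k L (Finsupp.single P (n : ℤ) - E - D₀) := by
    push_cast at h1; omega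
  have := Module.nontrivial_of_finrank_pos h6
  obtain ⟨⟨f, hf⟩, hf0⟩ := exists_ne (0 : rrSpace k L (Finsupp.single P (n : ℤ) - E - D₀))
  have hf0' : f ≠ 0 := fun h => hf0 (Subtype.ext h)
  have hle : D₀ ≤ Finsupp.single P (n : ℤ) - E + hL.principal f := by
    intro Q
    have h3 := (Q.ge_iff hf0').1 (mem_rrSpace.1 hf Q)
    simp only [Finsupp.coe_sub, Finsupp.coe_add, Pi.sub_apply, Pi.add_apply, principal_apply]
      at h3 ⊢
    linarith
  have h7 := hL.nonspecial_mono hP hle hD₀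
  rwa [hL.rrDim_add_principal _ hf0', divDeg_add, hL.divDeg_principal hP, add_zero] at h7

/-- Above `D` the value `deg - ℓ` is already maximal, so each added place raises `ℓ` by its full
degree and leading terms can be corrected one place at a time. -/
theorem exists_approx_of_nonspecial {D D' : Place k L →₀ ℤ} (h : D ≤ D')
    (hD : divDeg k L D - rrDim k L D + 1 = genus k L) :
    ∀ y : Place k L → L, (∀ Q : Place k L, Q.Ge (y Q) (-D' Q)) →
      ∃ f ∈ rrSpace k L D', ∀ Q : Place k L, Q.Ge (f - y Q) (-D Q) := by
  refine divisor_induction (D := D) (C := fun D' => ∀ y : Place k L → L,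
    (∀ Q : Place k L, Q.Ge (y Q) (-D' Q)) →
      ∃ f ∈ rrSpace k L D', ∀ Q : Place k L, Q.Ge (f - y Q) (-D Q)) ?_ ?_ D' h
  · intro y hy
    exact ⟨0, Submodule.zero_mem _, fun Q => by rw [zero_sub]; exact (hy Q).neg⟩
  · intro D' Q hDD' ih y hy
    have := hL.finiteDimensional_residueField Q
    have := hL.finiteDimensional_rrSpace hP (D' + Finsupp.single Q 1)
    have h1 := hL.nonspecial_mono hP hDD' hD
    have hle : D' ≤ D' + Finsupp.single Q 1 :=
      le_add_of_nonneg_right (Finsupp.single_nonneg.2 zero_le_one)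
    have h2 := hL.nonspecial_mono hP (hDD'.trans hle) hD
    rw [divDeg_add, divDeg_single] at h2
    obtain ⟨f₀, hf₀, hf₀'⟩ := Q.exists_sub_ge_of_finrank_step (rrSpace_le_geSub _ Q)
      (mem_rrSpace_iff_step D' Q) (by
        change rrDim k L _ = rrDim k L _ + _
        omega) (y Q) (hy Q)
    obtain ⟨f₁, hf₁, hf₁'⟩ := ih (fun R => y R - f₀) (fun R => by
      by_cases hR : Q = R
      · subst hR
        have := hf₀'.neg
        rw [neg_sub] at this
        exact this.mono (by simp)
      · have := (hy R).sub (mem_rrSpace.1 hf₀ R)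
        simpa [Finsupp.single_apply, hR] using this)
    refine ⟨f₀ + f₁, Submodule.add_mem _ hf₀ (rrSpace_mono hle hf₁), fun R => ?_⟩
    have := hf₁' R
    rwa [show f₁ - (y R - f₀) = f₀ + f₁ - y R by ring] at this

/-- Strong approximation away from a place `P` of degree one. -/
theorem exists_strong_approx (S : Finset (Place k L)) (hPS : P ∉ S) (M : ℕ) (y : Place k L → L)
    (hy : ∀ Q ∈ S, Q.Ge (y Q) 0) :
    ∃ f : L, (∀ Q, Q ≠ P → Q.Ge f 0) ∧ ∀ Q ∈ S, Q.Ge (f - y Q) M := by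
  classical
  set E : Place k L →₀ ℤ := ∑ Q ∈ S, Finsupp.single Q (M : ℤ) with hE
  have hEQ : ∀ Q, E Q = if Q ∈ S then (M : ℤ) else 0 := by
    intro Q
    simp [hE, Finsupp.single_apply]
  have hE0 : 0 ≤ E := fun Q => by rw [hEQ]; split_ifs <;> simp
  obtain ⟨n, hn⟩ := hL.exists_nonspecial_sub hP E
  obtain ⟨f, hf, hf'⟩ := hL.exists_approx_of_nonspecial hP
    (sub_le_self (Finsupp.single P (n : ℤ)) hE0) (hn n le_rfl) (fun Q => if Q ∈ S then y Q else 0)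
    (fun Q => by
      by_cases hQ : Q ∈ S
      · rw [if_pos hQ]
        have : P ≠ Q := fun h => hPS (h ▸ hQ)
        simpa [Finsupp.single_apply, this] using hy Q hQ
      · rw [if_neg hQ]; exact Q.ge_zero _)
  refine ⟨f, fun Q hQ => ?_, fun Q hQ => ?_⟩
  · simpa [Finsupp.single_apply, hQ.symm] using mem_rrSpace.1 hf Q
  · have h1 := hf' Q
    have : P ≠ Q := fun h => hPS (h ▸ hQ)
    simpa [hQ, hEQ, Finsupp.single_apply, this] using h1

end

end IsFunctionField

end

/-! ### Laurent series and the place defined by the expansion. -/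

section

variable {k : Type u} {L : Type v} [Field k] [Field L] [Algebra k L]

section Laurent

/-- The coefficients of `f` of degree less than `n` vanish. -/
def LGe (f : k⸨X⸩) (n : ℤ) : Prop := ∀ i < n, f.coeff i = 0

theorem LGe.mono {f : k⸨X⸩} {m n : ℤ} (h : LGe f n) (hmn : m ≤ n) : LGe f m :=
  fun i hi => h i (hi.trans_le hmn)

theorem exists_lGe (f : k⸨X⸩) : ∃ n, LGe f n :=
  ⟨f.order, fun _ hi => HahnSeries.coeff_eq_zero_of_lt_order hi⟩

theorem coeff_mul_eq_sum {f g : k⸨X⸩} {a b : ℤ} (hf : LGe f a) (hg : LGe g b) (c : ℤ) :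
    (f * g).coeff c = ∑ i ∈ Finset.Icc a (c - b), f.coeff i * g.coeff (c - i) := by
  rw [HahnSeries.coeff_mul]
  refine Finset.sum_bij_ne_zero (fun ij _ _ => ij.1) ?_ ?_ ?_ ?_
  · rintro ⟨i, j⟩ hij h0
    rw [Finset.mem_antidiagonal] at hij
    obtain ⟨h1, h2, h3⟩ := hij
    simp only [HahnSeries.mem_support] at h1 h2 h3
    have h4 : a ≤ i := by by_contra! h; exact h1 (hf i h)
    have h5 : b ≤ j := by by_contra! h; exact h2 (hg j h)
    simp only [Finset.mem_Icc]; omega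
  · rintro ⟨i, j⟩ hij _ ⟨i', j'⟩ hij' _ h
    rw [Finset.mem_antidiagonal] at hij hij'
    have h1 := hij.2.2; have h2 := hij'.2.2
    simp only at h h1 h2
    ext <;> simp only <;> omega
  · intro i hi h0
    refine ⟨(i, c - i), ?_, h0, rfl⟩
    rw [Finset.mem_antidiagonal]
    simp only [HahnSeries.mem_support]
    exact ⟨left_ne_zero_of_mul h0, right_ne_zero_of_mul h0, by omega⟩
  · rintro ⟨i, j⟩ hij h0
    rw [Finset.mem_antidiagonal] at hij
    have h1 := hij.2.2
    simp only at h1 ⊢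
    rw [show j = c - i by omega]

theorem LGe.mul {f g : k⸨X⸩} {a b : ℤ} (hf : LGe f a) (hg : LGe g b) : LGe (f * g) (a + b) := by
  intro i hi
  rw [coeff_mul_eq_sum hf hg, Finset.Icc_eq_empty (by omega), Finset.sum_empty]

theorem LGe.pow {f : k⸨X⸩} {a : ℤ} (hf : LGe f a) (n : ℕ) : LGe (f ^ n) (n * a) := by
  induction n with
  | zero =>
    intro i hi
    rw [pow_zero, HahnSeries.coeff_one, if_neg (by simp at hi; omega)]
  | succ n ih =>
    rw [pow_succ, Nat.cast_succ, add_mul, one_mul]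
    exact ih.mul hf

theorem coeff_derivative (f : k⸨X⸩) (n : ℤ) :
    (LaurentSeries.derivative k f).coeff n = ((n + 1 : ℤ) : k) * f.coeff (n + 1) := by
  rw [LaurentSeries.derivative_apply, LaurentSeries.hasseDeriv_coeff]
  simp

theorem LGe.derivative {f : k⸨X⸩} {a : ℤ} (hf : LGe f a) :
    LGe (LaurentSeries.derivative k f) (a - 1) := fun i hi => by
  rw [coeff_derivative, hf _ (by omega), mul_zero]

theorem derivative_mul (f g : k⸨X⸩) : LaurentSeries.derivative k (f * g) =
    f * LaurentSeries.derivative k g + g * LaurentSeries.derivative k f := by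
    obtain ⟨a, ha⟩ := exists_lGe f
    obtain ⟨b, hb⟩ := exists_lGe g
    ext n
    rw [coeff_derivative, HahnSeries.coeff_add, mul_comm g,
      coeff_mul_eq_sum ha hb, coeff_mul_eq_sum ha hb.derivative, coeff_mul_eq_sum ha.derivative hb]
    have h1 : ∑ i ∈ Finset.Icc (a - 1) (n - b),
        (LaurentSeries.derivative k f).coeff i * g.coeff (n - i) =
        ∑ i ∈ Finset.Icc a (n + 1 - b), (i : k) * f.coeff i * g.coeff (n + 1 - i) := by
      refine Finset.sum_bij (fun i _ => i + 1) (fun i hi => ?_) (fun i _ j _ h => by simpa using h)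
        (fun i hi => ⟨i - 1, ?_, by ring⟩) (fun i hi => ?_)
      · rw [Finset.mem_Icc] at hi ⊢; omega
      · rw [Finset.mem_Icc] at hi ⊢; omega
      · rw [coeff_derivative, show n + 1 - (i + 1) = n - i by ring]
    rw [h1, show n - (b - 1) = n + 1 - b by ring, ← Finset.sum_add_distrib, Finset.mul_sum]
    refine Finset.sum_congr rfl fun i _ => ?_
    rw [coeff_derivative, show n - i + 1 = n + 1 - i by ring]
    push_cast; ring

theorem derivative_C_mul (c : k) (f : k⸨X⸩) : LaurentSeries.derivative k (HahnSeries.C c * f) =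
    HahnSeries.C c * LaurentSeries.derivative k f := by
  ext n
  rw [coeff_derivative, HahnSeries.C_apply, HahnSeries.coeff_single_zero_mul,
    HahnSeries.coeff_single_zero_mul, coeff_derivative]
  ring

/-- The residue of `f dg`. -/
theorem residue_eq_sum {f g : k⸨X⸩} {a : ℤ} (hf : LGe f (-a)) (hg : LGe g (-a)) :
    (f * LaurentSeries.derivative k g).coeff (-1) =
      ∑ s ∈ Finset.Icc 1 a, (s : k) * (f.coeff (-s) * g.coeff s) -
      ∑ s ∈ Finset.Icc 1 a, (s : k) * (g.coeff (-s) * f.coeff s) := by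
  have h1 : (f * LaurentSeries.derivative k g).coeff (-1) =
      ∑ s ∈ Finset.Icc (-a) a, (s : k) * (f.coeff (-s) * g.coeff s) := by
    rw [coeff_mul_eq_sum hf hg.derivative]
    refine Finset.sum_bij (fun i _ => -i) (fun i hi => ?_) (fun i _ j _ h => by simpa using h)
        (fun i hi => ⟨-i, ?_, by ring⟩) (fun i hi => ?_)
    · rw [Finset.mem_Icc] at hi ⊢; omega
    · rw [Finset.mem_Icc] at hi ⊢; omega
    · rw [coeff_derivative, show -1 - i + 1 = -i by ring, neg_neg]; ring
  rw [h1, sub_eq_add_neg, ← Finset.sum_neg_distrib]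
  have h2 : ∑ s ∈ Finset.Icc 1 a, -((s : k) * (g.coeff (-s) * f.coeff s)) =
      ∑ s ∈ Finset.Icc (-a) (-1), (s : k) * (f.coeff (-s) * g.coeff s) := by
    refine Finset.sum_bij (fun i _ => -i) (fun i hi => ?_) (fun i _ j _ h => by simpa using h)
        (fun i hi => ⟨-i, ?_, by ring⟩) (fun i hi => ?_)
    · rw [Finset.mem_Icc] at hi ⊢; omega
    · rw [Finset.mem_Icc] at hi ⊢; omega
    · push_cast; rw [neg_neg]; ring
  rw [h2, ← Finset.sum_union (Finset.disjoint_left.2 fun s h3 h4 => by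
    rw [Finset.mem_Icc] at h3 h4; omega)]
  symm
  refine Finset.sum_subset (fun s hs => ?_) (fun s hs hs' => ?_)
  · rw [Finset.mem_union, Finset.mem_Icc, Finset.mem_Icc] at hs
    rw [Finset.mem_Icc]; omega
  · rw [Finset.mem_union, Finset.mem_Icc, Finset.mem_Icc] at hs'
    rw [Finset.mem_Icc] at hs
    rw [show s = 0 by omega]; simp

theorem lGe_iff_valuation {f : k⸨X⸩} {n : ℤ} :
    LGe f n ↔ Valued.v f ≤ (WithZero.exp (-n) : WithZero (Multiplicative ℤ)) :=
  (LaurentSeries.valuation_le_iff_coeff_lt_eq_zero k).symm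

end Laurent

theorem algHom_algebraMap (φ : L →ₐ[k] k⸨X⸩) (c : k) :
    φ (algebraMap k L c) = HahnSeries.C c := by
  rw [AlgHom.commutes, LaurentSeries.algebraMap_apply]

theorem single_zpow_eq (n : ℤ) :
    (HahnSeries.single (1 : ℤ) (1 : k) : k⸨X⸩) ^ n = HahnSeries.single n 1 :=
  (RatFunc.single_zpow n).symm

/-- The place at which `x` is a local parameter, defined by an embedding in the Laurent series. -/
theorem IsFunctionField.exists_place (hL : IsFunctionField k L) (φ : L →ₐ[k] k⸨X⸩) (x : L)
    (hx : φ x = HahnSeries.single 1 1) :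
    ∃ P : Place k L, P.deg = 1 ∧ ∀ (f : L) (n : ℤ), P.Ge f n ↔ LGe (φ f) n := by
  let w : Valuation L (WithZero (Multiplicative ℤ)) :=
    (Valued.v : Valuation k⸨X⸩ (WithZero (Multiplicative ℤ))).comap φ.toRingHom
  have hw : ∀ f, w f = Valued.v (φ f) := fun _ => rfl
  have hmem : ∀ f, f ∈ w.valuationSubring ↔ LGe (φ f) 0 := fun f => by
    rw [Valuation.mem_valuationSubring_iff, hw, lGe_iff_valuation, neg_zero, WithZero.exp_zero]
  have hx0 : x ≠ 0 := by
    rintro rfl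
    rw [map_zero] at hx
    have := congrArg (fun f : k⸨X⸩ => f.coeff 1) hx
    simp at this
  have hxn : ∀ n : ℤ, φ (x ^ n) = HahnSeries.single n 1 := fun n => by
    rw [map_zpow₀, hx, single_zpow_eq]
  have hk : ∀ c : k, algebraMap k L c ∈ w.valuationSubring := fun c => by
    rw [hmem, algHom_algebraMap]
    intro i hi
    rw [HahnSeries.C_apply, HahnSeries.coeff_single_of_ne hi.ne]
  have hxinv : x⁻¹ ∉ w.valuationSubring := by
    rw [hmem, ← zpow_neg_one, hxn]
    intro h
    have := h (-1) (by norm_num)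
    rw [HahnSeries.coeff_single_same] at this
    exact one_ne_zero this
  obtain ⟨P, hPw⟩ : ∃ P : Place k L, P.ring = w.valuationSubring :=
    ⟨⟨w.valuationSubring, hk, hL.isDVR _ hk hxinv⟩, rfl⟩
  have hP0 : ∀ f, P.Ge f 0 ↔ LGe (φ f) 0 := fun f => by rw [← P.mem_ring_iff, hPw]; exact hmem f
  have hwx : ∀ n : ℤ, w (x ^ n) = WithZero.exp (-n) := by
    intro n
    rw [hw, hxn, LaurentSeries.valuation_single_zpow]
  have hord : ∀ f : L, f ≠ 0 → ∃ a : ℤ, w f = WithZero.exp (-a) ∧ P.ord f = a * P.ord x := by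
    intro f hf
    have hwf : w f ≠ 0 := (Valuation.ne_zero_iff _).2 hf
    refine ⟨-WithZero.log (w f), by rw [neg_neg, WithZero.exp_log hwf], ?_⟩
    have hz : ∀ m : ℤ, x ^ m ≠ 0 := fun m => zpow_ne_zero _ hx0
    have hw1 : w (f * x ^ (WithZero.log (w f))) = 1 := by
      rw [map_mul, hwx, WithZero.exp_neg, WithZero.exp_log hwf, mul_inv_cancel₀ hwf]
    have hne := mul_ne_zero hf (hz (WithZero.log (w f)))
    have h1 : P.Ge (f * x ^ (WithZero.log (w f))) 0 := by
      rw [hP0, lGe_iff_valuation, ← hw, hw1]; simp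
    have h2 : P.Ge (f * x ^ (WithZero.log (w f)))⁻¹ 0 := by
      rw [hP0, lGe_iff_valuation, ← hw, map_inv₀, hw1]; simp
    rw [P.ge_iff hne] at h1
    rw [P.ge_iff (inv_ne_zero hne), P.ord_inv] at h2
    rw [P.ord_mul hf (hz _), P.ord_zpow] at h1 h2
    linarith
  -- All orders at `P` are multiples of that of `x`, and a local parameter has order `1`; this
  -- leaves `±1`.
  have hordx : P.ord x = 1 := by
    obtain ⟨b, _, hb⟩ := hord _ P.localParam_ne_zero
    rw [P.ord_localParam] at hb
    have h1 : 0 ≤ P.ord x := by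
      rw [← P.ge_iff hx0, hP0, hx]
      intro i hi
      rw [HahnSeries.coeff_single_of_ne (by omega)]
    rcases Int.eq_one_or_neg_one_of_mul_eq_one (by rw [mul_comm, ← hb] : P.ord x * b = 1) with h | h
    · exact h
    · omega
  have hPn : ∀ (f : L) (n : ℤ), P.Ge f n ↔ LGe (φ f) n := by
    intro f n
    by_cases hf : f = 0
    · rw [hf, map_zero]; exact ⟨fun _ i _ => by simp, fun _ => P.ge_zero n⟩
    obtain ⟨a, ha, hoa⟩ := hord f hf
    rw [P.ge_iff hf, hoa, hordx, mul_one, lGe_iff_valuation, ← hw, ha, WithZero.exp_le_exp]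
    omega
  refine ⟨P, ?_, hPn⟩
  change Module.finrank k (IsLocalRing.ResidueField P.ring) = 1
  refine finrank_eq_one (1 : IsLocalRing.ResidueField P.ring) one_ne_zero fun r => ?_
  obtain ⟨f, rfl⟩ := IsLocalRing.residue_surjective r
  refine ⟨(φ (f : L)).coeff 0, ?_⟩
  rw [Algebra.smul_def, mul_one]
  change IsLocalRing.residue P.ring (algebraMap k P.ring _) = _
  rw [← sub_eq_zero, ← map_sub, P.residue_eq_zero_iff, hPn]
  intro i hi
  change (φ (algebraMap k L _ - (f : L))).coeff i = 0
  rw [map_sub, algHom_algebraMap, HahnSeries.coeff_sub, HahnSeries.C_apply, sub_eq_zero]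
  have hf : LGe (φ (f : L)) 0 := (hP0 _).1 ((P.mem_ring_iff _).1 f.2)
  rcases lt_or_eq_of_le (Int.lt_add_one_iff.1 hi : i ≤ 0) with h | h
  · rw [hf i h, HahnSeries.coeff_single_of_ne h.ne]
  · rw [h, HahnSeries.coeff_single_same]

/-- Functions regular away from `P` with prescribed large principal part. -/
theorem IsFunctionField.exists_principal_part (hL : IsFunctionField k L) {P : Place k L}
    (hP : P.deg = 1) : ∃ N : ℕ, ∀ y : L, ∃ f : L, (∀ Q, Q ≠ P → Q.Ge f 0) ∧ P.Ge (f - y) (-N) := by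
  classical
  obtain ⟨N, hN⟩ := hL.exists_nonspecial_sub hP 0
  refine ⟨N, fun y => ?_⟩
  have h0 := hN N le_rfl
  rw [sub_zero] at h0
  have hle : Finsupp.single P (N : ℤ) ≤ Finsupp.single P (max (N : ℤ) (-P.ord y)) :=
    Finsupp.single_le_single.2 (le_max_left _ _)
  obtain ⟨f, hf, hf'⟩ := hL.exists_approx_of_nonspecial hP hle h0 (fun Q => if Q = P then y else 0)
    (fun Q => by
      by_cases hQ : Q = P
      · subst hQ
        rw [if_pos rfl, Finsupp.single_eq_same]
        exact (Q.ge_ord y).mono (by omega)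
      · rw [if_neg hQ]; exact Q.ge_zero _)
  refine ⟨f, fun Q hQ => ?_, ?_⟩
  · simpa [Finsupp.single_apply, Ne.symm hQ] using mem_rrSpace.1 hf Q
  · simpa using hf' P

end

/-! ### The residue of `f dg` as the trace of a commutator. -/

section

variable {k : Type u} {L : Type v} [Field k] [Field L] [Algebra k L]

theorem mem_rrSpace_single {P : Place k L} {m : ℤ} {f : L} :
    f ∈ rrSpace k L (Finsupp.single P m) ↔ (∀ Q, Q ≠ P → Q.Ge f 0) ∧ P.Ge f (-m) := by
  classical
  rw [mem_rrSpace]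
  refine ⟨fun h => ⟨fun Q hQ => by simpa [Finsupp.single_apply, hQ.symm] using h Q,
    by simpa using h P⟩, fun h Q => ?_⟩
  by_cases hQ : Q = P
  · subst hQ; simpa using h.2
  · simpa [Finsupp.single_apply, Ne.symm hQ] using h.1 Q hQ

/-- The coefficient of degree `i` of the expansion of a function. -/
def expansionCoeff (φ : L →ₐ[k] k⸨X⸩) (i : ℤ) : L →ₗ[k] k where
  toFun r := (φ r).coeff i
  map_add' r s := by rw [map_add, HahnSeries.coeff_add]
  map_smul' c r := by
    rw [Algebra.smul_def, map_mul, algHom_algebraMap, HahnSeries.C_apply,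
      HahnSeries.coeff_single_zero_mul]
    rfl

/-- A difference `s = j - i` arises from exactly `s` pairs. This produces the factor `s` that
differentiation puts in the residue. -/
theorem sum_Ioc_sum_Icc {M : Type*} [Ring M] (F : ℤ → M) (n a : ℤ) :
    ∑ j ∈ Finset.Ioc n (n + a), ∑ i ∈ Finset.Icc (j - a) n, F (j - i) =
      ∑ s ∈ Finset.Icc 1 a, (s : M) * F s := by
  have h1 : ∀ j, ∑ i ∈ Finset.Icc (j - a) n, F (j - i) = ∑ s ∈ Finset.Icc (j - n) a, F s := by
    intro j
    refine Finset.sum_bij (fun i _ => j - i) (fun i hi => ?_) (fun i _ i' _ h => by simpa using h)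
        (fun i hi => ⟨j - i, ?_, by ring⟩) (fun i hi => rfl)
    · rw [Finset.mem_Icc] at hi ⊢; omega
    · rw [Finset.mem_Icc] at hi ⊢; omega
  simp only [h1]
  rw [Finset.sum_comm' (t' := Finset.Icc 1 a) (s' := fun s => Finset.Ioc n (n + s)) (fun j s => by
    simp only [Finset.mem_Ioc, Finset.mem_Icc]; omega)]
  refine Finset.sum_congr rfl fun s hs => ?_
  rw [Finset.mem_Icc] at hs
  rw [Finset.sum_const, Int.card_Ioc, nsmul_eq_mul]
  congr 1
  have : (((n + s - n).toNat : ℤ)) = s := by omega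
  exact_mod_cast congrArg (Int.cast : ℤ → M) this

/-- The residue at `P` of `f dg` vanishes if `f` and `g` are regular away from `P`. -/
theorem IsFunctionField.residue_mul_derivative_eq_zero (hL : IsFunctionField k L) {P : Place k L}
    (hP : P.deg = 1) {φ : L →ₐ[k] k⸨X⸩} (hφ : ∀ (f : L) (n : ℤ), P.Ge f n ↔ LGe (φ f) n)
    {x : L} (hx : φ x = HahnSeries.single 1 1) {f g : L} (hf : ∀ Q, Q ≠ P → Q.Ge f 0)
    (hg : ∀ Q, Q ≠ P → Q.Ge g 0) :
    (φ f * LaurentSeries.derivative k (φ g)).coeff (-1) = 0 := by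
  -- Multiplications by `f` and `g`, compressed to the finite-dimensional space `L(nP)`, no longer
  -- commute. The trace of their commutator is zero, and only the terms pushed past pole order `n`
  -- contribute to it; they add up to the residue.
  obtain ⟨N, hN⟩ := hL.exists_principal_part hP
  choose e he heN using fun j : ℤ => hN (x ^ (-j))
  obtain ⟨a, haf, hag⟩ : ∃ a : ℕ, LGe (φ f) (-a) ∧ LGe (φ g) (-a) := by
    obtain ⟨a, ha⟩ := exists_lGe (φ f)
    obtain ⟨b, hb⟩ := exists_lGe (φ g)
    exact ⟨a.natAbs + b.natAbs, ha.mono (by omega), hb.mono (by omega)⟩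
  have he_coeff : ∀ j i : ℤ, i < -N → (φ (e j)).coeff i = if i = -j then 1 else 0 := by
    intro j i hi
    have h1 := (hφ _ _).1 (heN j) i hi
    rw [map_sub, map_zpow₀, hx, single_zpow_eq, HahnSeries.coeff_sub, sub_eq_zero] at h1
    rw [h1, HahnSeries.coeff_single]
    congr
  -- The functions `e j` equal `x ^ (-j)` up to terms of degree at least `-N`. With this `n`, the
  -- error times a function with pole of order at most `a` stays clear of all degrees used in the
  -- trace, and `b` leaves room for the products.
  set n : ℤ := N + 2 * a + 1 with hn
  set b : ℤ := n + 3 * a with hb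
  set R : ℤ → Submodule k L := fun m => rrSpace k L (Finsupp.single P m) with hR
  have hRle : ∀ {m m' : ℤ} {r : L}, r ∈ R m → m ≤ m' → r ∈ R m' := by
    intro m m' r hr hm
    exact rrSpace_mono (Finsupp.single_le_single.2 hm) hr
  have hRmul : ∀ {m m' : ℤ} {r s : L}, r ∈ R m → s ∈ R m' → r * s ∈ R (m + m') := by
    intro m m' r s hr hs
    rw [mem_rrSpace_single] at *
    exact ⟨fun Q hQ => by simpa using (hr.1 Q hQ).mul (hs.1 Q hQ),
      (hr.2.mul hs.2).mono (by omega)⟩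
  have hRcoeff : ∀ {m : ℤ} {r : L}, r ∈ R m → LGe (φ r) (-m) := fun hr =>
    (hφ _ _).1 (mem_rrSpace_single.1 hr).2
  have hRe : ∀ j : ℤ, (N : ℤ) ≤ j → e j ∈ R j := by
    intro j hj
    rw [mem_rrSpace_single, hφ]
    refine ⟨he j, fun i hi => ?_⟩
    rw [he_coeff j i (by omega), if_neg hi.ne]
  have hfR : f ∈ R a := mem_rrSpace_single.2 ⟨hf, (hφ _ _).2 haf⟩
  have hgR : g ∈ R a := mem_rrSpace_single.2 ⟨hg, (hφ _ _).2 hag⟩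
  have hRfin : FiniteDimensional k (R n) := hL.finiteDimensional_rrSpace hP _
  set c : ℤ → L →ₗ[k] k := expansionCoeff φ with hc
  have hcφ : ∀ i r, c i r = (φ r).coeff i := fun _ _ => rfl
  -- `q` rebuilds from the `e j` the terms of degrees `-b` to `-n - 1`; removing them with `p` maps
  -- `L(bP)` into `L(nP)`.
  set q : L →ₗ[k] L := ∑ j ∈ Finset.Ioc n b, (c (-j)).smulRight (e j) with hq
  have hq_apply : ∀ r, q r = ∑ j ∈ Finset.Ioc n b, c (-j) r • e j := fun r => by
    simp [hq, LinearMap.sum_apply]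
  set p : L →ₗ[k] L := LinearMap.id - q with hp
  have hp_apply : ∀ r, p r = r - q r := fun r => rfl
  have hq_coeff : ∀ r (i : ℤ), i < -N →
      c i (q r) = if -i ∈ Finset.Ioc n b then c i r else 0 := by
    intro r i hi
    rw [hq_apply, map_sum]
    have : ∀ j ∈ Finset.Ioc n b, c i (c (-j) r • e j) = if j = -i then c i r else 0 := by
      intro j _
      rw [map_smul, hcφ i (e j), he_coeff j i hi, smul_eq_mul]
      by_cases h : j = -i
      · rw [if_pos h, if_pos (by omega), mul_one, h, neg_neg]
      · rw [if_neg h, if_neg (by omega), mul_zero]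
    rw [Finset.sum_congr rfl this, Finset.sum_ite_eq' ]
  have hp_mem : ∀ r ∈ R b, p r ∈ R n := by
    intro r hr
    have h1 : q r ∈ R b := by
      rw [hq_apply]
      refine Submodule.sum_mem _ fun j hj => Submodule.smul_mem _ _ ?_
      rw [Finset.mem_Ioc] at hj
      exact hRle (hRe j (by omega)) hj.2
    have h2 := Submodule.sub_mem _ hr h1
    refine mem_rrSpace_single.2 ⟨(mem_rrSpace_single.1 h2).1, (hφ _ _).2 fun i hi => ?_⟩
    rw [← hcφ, hp_apply, map_sub, hq_coeff r i (by omega)]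
    by_cases hib : -i ≤ b
    · rw [if_pos (by rw [Finset.mem_Ioc]; omega), sub_self]
    · rw [if_neg (by rw [Finset.mem_Ioc]; omega), sub_zero]
      exact hRcoeff hr i (by omega)
  have hp_coeff : ∀ r (i : ℤ), -n ≤ i → i < -N → c i (p r) = c i r := by
    intro r i hi hi'
    rw [hp_apply, map_sub, hq_coeff r i hi', if_neg (by rw [Finset.mem_Ioc]; omega), sub_zero]
  have hmem1 : ∀ h ∈ R a, ∀ r ∈ R n, (p ∘ₗ LinearMap.mulLeft k h) r ∈ R n := fun h hh r hr =>
    hp_mem _ (hRle (hRmul hh hr) (by omega))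
  have hmem2 : ∀ h ∈ R a, ∀ j ∈ Finset.Ioc n (n + a), p (h * e j) ∈ R n := fun h hh j hj => by
    rw [Finset.mem_Ioc] at hj
    exact hp_mem _ (hRle (hRmul hh (hRe j (by omega))) (by omega))
  let T : R a → Module.End k (R n) := fun h => LinearMap.restrict _ (hmem1 h h.2)
  let U : R a → R a → Module.End k (R n) := fun h h' => ∑ j ∈ (Finset.Ioc n (n + a)).attach,
    (c (-j) ∘ₗ LinearMap.mulLeft k (h' : L) ∘ₗ (R n).subtype).smulRight
      (⟨p (h * e j), hmem2 h h.2 j j.2⟩ : R n)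
  have hU_apply : ∀ h h' (r : R n), ((U h h' r : R n) : L) = p (h * q (h' * r)) := by
    intro h h' r
    have h1 : q (h' * r) = ∑ j ∈ Finset.Ioc n (n + a), c (-j) ((h' : L) * r) • e j := by
      rw [hq_apply]
      symm
      refine Finset.sum_subset (Finset.Ioc_subset_Ioc_right (by omega)) fun j _ hj => ?_
      rw [hcφ, hRcoeff (hRmul h'.2 r.2) (-j), zero_smul]
      rw [Finset.mem_Ioc] at *
      omega
    rw [h1, Finset.mul_sum, map_sum]
    simp only [U, LinearMap.sum_apply]
    rw [AddSubmonoidClass.coe_finsetSum, ← Finset.sum_attach (Finset.Ioc n (n + a))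
      (fun j => p ((h : L) * (c (-j) ((h' : L) * r) • e j)))]
    refine Finset.sum_congr rfl fun j _ => ?_
    rw [mul_smul_comm, map_smul]
    rfl
  -- The common part `p (h * h' * r)` cancels, leaving only the truncation terms.
  have hcomm : ∀ h h' : R a, T h * T h' - T h' * T h = U h' h - U h h' := by
    intro h h'
    ext r
    have h1 : ∀ h h' : R a, (((T h * T h') r : R n) : L) =
        p (h * (h' * r)) - p (h * q (h' * r)) := by
      intro h h'
      change p (h * p (h' * r)) = _
      rw [hp_apply (h' * r), mul_sub, map_sub]
    rw [LinearMap.sub_apply, LinearMap.sub_apply, Submodule.coe_sub, Submodule.coe_sub, h1, h1,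
      hU_apply, hU_apply, mul_left_comm (h : L)]
    abel
  have htrace : ∀ h h' : R a, LinearMap.trace k (R n) (U h h') =
      ∑ s ∈ Finset.Icc 1 (a : ℤ), (s : k) * ((φ h').coeff (-s) * (φ h).coeff s) := by
    intro h h'
    simp only [U, map_sum, LinearMap.trace_smulRight]
    rw [← sum_Ioc_sum_Icc (fun s => (φ (h' : L)).coeff (-s) * (φ (h : L)).coeff s) n a,
      ← Finset.sum_attach (Finset.Ioc n (n + a))]
    refine Finset.sum_congr rfl fun j _ => ?_
    have hj := Finset.mem_Ioc.1 j.2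
    change c (-j) ((h' : L) * p (h * e j)) = _
    rw [hcφ, map_mul, coeff_mul_eq_sum (hRcoeff h'.2) (hRcoeff (hmem2 h h.2 j j.2))]
    refine Finset.sum_bij (fun i _ => i + j) (fun i hi => ?_) (fun i _ i' _ h => by simpa using h)
      (fun i hi => ⟨i - j, ?_, by ring⟩) (fun i hi => ?_)
    · rw [Finset.mem_Icc] at hi ⊢; omega
    · rw [Finset.mem_Icc] at hi ⊢; omega
    · rw [Finset.mem_Icc] at hi
      rw [show -((j : ℤ) - (i + j)) = i by ring, show (j : ℤ) - (i + j) = -i by ring]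
      congr 1
      rw [← hcφ, hp_coeff _ _ (by omega) (by omega), hcφ, map_mul]
      have h2 : φ (e j) = HahnSeries.single (-(j : ℤ)) 1 + φ (e j - x ^ (-(j : ℤ))) := by
        rw [map_sub, map_zpow₀, hx, single_zpow_eq]; abel
      rw [h2, mul_add, HahnSeries.coeff_add, HahnSeries.coeff_mul_single, mul_one,
        ((hRcoeff h.2).mul ((hφ _ _).1 (heN j))) _ (by omega), add_zero]
      congr 1; ring
  have hsub : ∀ A B : Module.End k (R n), LinearMap.trace k (R n) (A - B) =
      LinearMap.trace k (R n) A - LinearMap.trace k (R n) B := fun A B =>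
    map_sub (LinearMap.trace k (R n)) A B
  have h0 : LinearMap.trace k (R n) (U ⟨g, hgR⟩ ⟨f, hfR⟩ - U ⟨f, hfR⟩ ⟨g, hgR⟩) = 0 := by
    rw [← hcomm, hsub, LinearMap.trace_mul_comm, sub_self]
  rw [hsub, htrace, htrace] at h0
  rw [residue_eq_sum haf hag]
  exact h0

end

/-! ### Bases over the field of `p`-th powers and orders of differentials. -/

section

open IntermediateField in
/-- Over the field of `p`-th powers, a function field of dimension one over a perfect field has
degree at most `p`. -/
theorem IsFunctionField.finrank_frobenius {k : Type u} {L : Type v} [Field k] [Field L]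
    [Algebra k L] (p : ℕ) [Fact p.Prime] [CharP k p] [CharP L p] [PerfectField k]
    (hL : IsFunctionField k L) {t : L} (ht : Transcendental k t) :
    0 < Module.finrank (frobenius L p).fieldRange L ∧
      Module.finrank (frobenius L p).fieldRange L ≤ p := by
  have hp : p.Prime := Fact.out
  set A : Subfield L := k⟮t⟯.toSubfield with hA
  set A' : Subfield L := A.map (frobenius L p) with hA'
  have hmap : (⊤ : Subfield L).map (frobenius L p) = (frobenius L p).fieldRange :=
    (RingHom.fieldRange_eq_map _).symm
  have hA'A : A' ≤ A := by
    rintro _ ⟨a, ha, rfl⟩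
    rw [frobenius_def]
    exact pow_mem ha p
  have hkA' : ∀ c : k, algebraMap k L c ∈ A' := fun c => by
    obtain ⟨b, rfl⟩ := surjective_frobenius k p c
    exact ⟨algebraMap k L b, k⟮t⟯.algebraMap_mem b, by simp [frobenius_def]⟩
  have htA : t ∈ A := mem_adjoin_simple_self k t
  have htp : t ^ p ∈ A' := ⟨t, htA, frobenius_def _ _⟩
  have hn : 0 < A.relfinrank ⊤ := by
    rw [Subfield.relfinrank_top_right]
    have : FiniteDimensional k⟮t⟯ L := hL.finiteDimensional ht
    exact Module.finrank_pos (R := k⟮t⟯) (M := L)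
  -- With `A = k(t)`, the degree `[L : Aᵖ]` is computed through `A` and through `Lᵖ`. Since
  -- Frobenius gives `[Lᵖ : Aᵖ] = [L : A]`, what remains is `[L : Lᵖ] = [A : Aᵖ]`.
  have h1 : A'.relfinrank A * A.relfinrank ⊤ = A'.relfinrank ⊤ :=
    Subfield.relfinrank_mul_relfinrank hA'A le_top
  have h2 : A'.relfinrank (frobenius L p).fieldRange * (frobenius L p).fieldRange.relfinrank ⊤ =
      A'.relfinrank ⊤ :=
    Subfield.relfinrank_mul_relfinrank (by
      rw [← hmap]; exact (Subfield.gc_map_comap (frobenius L p)).monotone_l le_top) le_top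
  rw [← hmap, Subfield.relfinrank_map_map, hmap, mul_comm] at h2
  have h3 : A'.relfinrank A = (frobenius L p).fieldRange.relfinrank ⊤ :=
    Nat.eq_of_mul_eq_mul_right hn (h1.trans h2.symm)
  rw [← Subfield.relfinrank_top_right, ← h3, Subfield.relfinrank_eq_finrank_of_le hA'A]
  -- As `k` is perfect, `Aᵖ` contains `k`, so `t` generates `A` over it.
  have hext : Subfield.extendScalars hA'A = A'⟮t⟯ := by
    apply le_antisymm
    · intro a ha
      have ha : a ∈ A := ha
      rw [hA, adjoin_toSubfield] at ha
      refine (Subfield.closure_le (t := A'⟮t⟯.toSubfield)).2 ?_ ha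
      rintro y (⟨c, rfl⟩ | rfl)
      · exact A'⟮t⟯.algebraMap_mem ⟨_, hkA' c⟩
      · exact mem_adjoin_simple_self A' _
    · rw [adjoin_simple_le_iff]
      exact htA
  have hroot : Polynomial.aeval t (Polynomial.X ^ p - Polynomial.C (⟨t ^ p, htp⟩ : A')) = 0 := by
    simp only [map_sub, map_pow, Polynomial.aeval_X, Polynomial.aeval_C]
    exact sub_self _
  have hmon : (Polynomial.X ^ p - Polynomial.C (⟨t ^ p, htp⟩ : A')).Monic :=
    Polynomial.monic_X_pow_sub_C _ hp.ne_zero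
  have hint : IsIntegral A' t := ⟨_, hmon, by rwa [Polynomial.aeval_def] at hroot⟩
  rw [hext, IntermediateField.adjoin.finrank hint]
  refine ⟨minpoly.natDegree_pos hint, ?_⟩
  have := Polynomial.natDegree_le_of_dvd (minpoly.dvd A' t hroot) hmon.ne_zero
  rwa [Polynomial.natDegree_X_pow_sub_C] at this

namespace Place

variable {k : Type u} {L : Type v} [Field k] [Field L] [Algebra k L]

/-- A sum of functions of distinct orders does not vanish, and its order is at most the order
of each of them. -/
theorem sum_ne_zero_of_ord_injOn (Q : Place k L) {ι : Type*} {s : Finset ι} (hs : s.Nonempty)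
    {f : ι → L} (hf : ∀ i ∈ s, f i ≠ 0) (hinj : Set.InjOn (fun i => Q.ord (f i)) s) :
    ∑ i ∈ s, f i ≠ 0 ∧ ∀ i ∈ s, Q.ord (∑ i ∈ s, f i) ≤ Q.ord (f i) := by
  classical
  obtain ⟨j, hj, hmin⟩ := s.exists_min_image (fun i => Q.ord (f i)) hs
  have h := Q.ord_add_eq (hf j hj) (g := ∑ i ∈ s.erase j, f i) <| Ge.sum fun i hi => by
    rw [Finset.mem_erase] at hi
    rw [Q.ge_iff (hf i hi.2)]
    have h1 := hmin i hi.2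
    have h2 : Q.ord (f i) ≠ Q.ord (f j) := fun h => hi.1 (hinj hi.2 hj h)
    omega
  rw [Finset.add_sum_erase _ _ hj] at h
  exact ⟨h.1, fun i hi => h.2 ▸ hmin i hi⟩

variable (p : ℕ) [Fact p.Prime]

/-- If the order of `t` is prime to `p`, then the terms of a sum `∑ aᵢᵖ tⁱ`, `i < p`, have at least
the order of the sum. -/
theorem ge_of_sum_pow (Q : Place k L) {t : L} (ht : ¬ (p : ℤ) ∣ Q.ord t) {a : Fin p → L} {n : ℤ}
    (h : Q.Ge (∑ i, a i ^ p * t ^ (i : ℕ)) n) (i : Fin p) : Q.Ge (a i ^ p * t ^ (i : ℕ)) n := by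
  classical
  have hp : p.Prime := Fact.out
  have hp' : Prime (p : ℤ) := Nat.prime_iff_prime_int.1 hp
  have ht0 : t ≠ 0 := by
    rintro rfl
    simp at ht
  by_cases hi : a i = 0
  · rw [hi, zero_pow hp.ne_zero, zero_mul]; exact Q.ge_zero n
  set s : Finset (Fin p) := Finset.univ.filter fun i => a i ≠ 0
  have hsum : ∑ i, a i ^ p * t ^ (i : ℕ) = ∑ i ∈ s, a i ^ p * t ^ (i : ℕ) := by
    rw [Finset.sum_filter_of_ne]
    intro i _ hne h0
    rw [h0, zero_pow hp.ne_zero, zero_mul] at hne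
    exact hne rfl
  have his : i ∈ s := by simpa [s] using hi
  have hne : ∀ i ∈ s, a i ^ p * t ^ (i : ℕ) ≠ 0 := fun i hi => by
    have : a i ≠ 0 := by simpa [s] using hi
    exact mul_ne_zero (pow_ne_zero _ this) (pow_ne_zero _ ht0)
  have hord : ∀ i ∈ s, Q.ord (a i ^ p * t ^ (i : ℕ)) = p * Q.ord (a i) + i * Q.ord t := by
    intro i hi
    have : a i ≠ 0 := by simpa [s] using hi
    rw [ord_mul _ (pow_ne_zero _ this) (pow_ne_zero _ ht0), ord_pow, ord_pow]
  -- The orders `p * ord (a i) + i * ord t` are pairwise incongruent modulo `p`, so nothing cancels.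
  obtain ⟨h0, hle⟩ := Q.sum_ne_zero_of_ord_injOn ⟨i, his⟩ hne (by
    intro i hi j hj hij
    simp only at hij
    rw [hord i hi, hord j hj] at hij
    have h1 : (p : ℤ) ∣ ((i : ℤ) - j) * Q.ord t := ⟨Q.ord (a j) - Q.ord (a i), by linarith⟩
    have h2 := (hp'.dvd_mul.1 h1).resolve_right ht
    have h3 := Int.eq_zero_of_abs_lt_dvd h2 (by rw [abs_lt]; omega)
    exact Fin.ext (by omega))
  rw [hsum, Q.ge_iff h0] at h
  exact (Q.ge_iff (hne i his)).2 (h.trans (hle i his))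

theorem eq_zero_of_sum_pow (Q : Place k L) {t : L} (ht : ¬ (p : ℤ) ∣ Q.ord t) {a : Fin p → L}
    (h : ∑ i, a i ^ p * t ^ (i : ℕ) = 0) (i : Fin p) : a i = 0 := by
  have hp : p.Prime := Fact.out
  have ht0 : t ≠ 0 := by
    rintro rfl
    simp at ht
  by_contra hi
  have h1 : a i ^ p * t ^ (i : ℕ) ≠ 0 := mul_ne_zero (pow_ne_zero _ hi) (pow_ne_zero _ ht0)
  have h2 := Q.ge_of_sum_pow p ht (h ▸ Q.ge_zero (Q.ord (a i ^ p * t ^ (i : ℕ)) + 1)) i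
  rw [Q.ge_iff h1] at h2
  omega

/-- The powers `1, t, …, t ^ (p - 1)` of a function of order prime to `p` are a basis over the
field of `p`-th powers. -/
theorem exists_sum_pow [CharP k p] [CharP L p] [PerfectField k] (hL : IsFunctionField k L)
    (Q : Place k L) {t : L} (ht : ¬ (p : ℤ) ∣ Q.ord t) (y : L) :
    ∃ a : Fin p → L, y = ∑ i, a i ^ p * t ^ (i : ℕ) := by
  have ht' : Transcendental k t :=
    Q.transcendental_of_ord_ne_zero fun h => ht (h ▸ dvd_zero _)
  obtain ⟨h0, hle⟩ := hL.finrank_frobenius p ht'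
  set F := (frobenius L p).fieldRange with hF
  have : Module.Finite F L := Module.finite_of_finrank_pos h0
  have hroot : ∀ g : F, ∃ a : L, a ^ p = g := fun g => by
    obtain ⟨a, ha⟩ := g.2
    exact ⟨a, by rw [← ha, frobenius_def]⟩
  have hli : LinearIndependent F fun i : Fin p => t ^ (i : ℕ) := by
    rw [Fintype.linearIndependent_iff]
    intro g hg i
    choose a ha using fun i => hroot (g i)
    have h1 := Q.eq_zero_of_sum_pow p ht (a := a) (by simpa [ha, Subfield.smul_def] using hg) i
    have h2 := ha i
    rw [h1, zero_pow (Fact.out : p.Prime).ne_zero] at h2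
    exact Subtype.ext h2.symm
  have hcard : Fintype.card (Fin p) = Module.finrank F L :=
    le_antisymm hli.fintype_card_le_finrank (by simpa using hle)
  have hspan := hli.span_eq_top_of_card_eq_finrank' hcard
  have hy : y ∈ Submodule.span F (Set.range fun i : Fin p => t ^ (i : ℕ)) := by
    rw [hspan]; trivial
  obtain ⟨g, hg⟩ := (Submodule.mem_span_range_iff_exists_fun F).1 hy
  choose a ha using fun i => hroot (g i)
  exact ⟨a, by simpa [ha, Subfield.smul_def] using hg.symm⟩

end Place

section derivations

variable {k : Type u} {L : Type v} [Field k] [Field L] [Algebra k L] (p : ℕ) [Fact p.Prime]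
  [CharP L p]

open KaehlerDifferential

omit [Fact p.Prime] in
theorem D_pow_eq_zero (a : L) : D k L (a ^ p) = 0 := by
  rw [Derivation.leibniz_pow, ← Nat.cast_smul_eq_nsmul L, CharP.cast_eq_zero, zero_smul]

omit [Fact p.Prime] in
theorem D_pow_mul (a y : L) : D k L (a ^ p * y) = a ^ p • D k L y := by
  rw [Derivation.leibniz, D_pow_eq_zero, smul_zero, add_zero]

omit [Fact p.Prime] in
theorem D_sum_pow (a : Fin p → L) (t : L) : D k L (∑ i, a i ^ p * t ^ (i : ℕ)) =
    (∑ i : Fin p, ((i : ℕ) : L) * (a i ^ p * t ^ ((i : ℕ) - 1))) • D k L t := by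
  rw [map_sum, Finset.sum_smul]
  refine Finset.sum_congr rfl fun i _ => ?_
  rw [D_pow_mul, Derivation.leibniz_pow, ← Nat.cast_smul_eq_nsmul L, smul_smul, smul_smul]
  congr 1
  ring

/-- The coefficient of the derivative with respect to a local parameter has order at least
`n - 1`, and at least `0` for a regular function. -/
theorem exists_D_eq_smul [CharP k p] [PerfectField k] (hL : IsFunctionField k L) (Q : Place k L)
    {y : L} {n : ℤ} (hy : Q.Ge y n) : ∃ c : L, D k L y = c • D k L Q.localParam ∧
      Q.Ge c (n - 1) ∧ (0 ≤ n → Q.Ge c 0) := by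
  have hp : p.Prime := Fact.out
  have ht : ¬ (p : ℤ) ∣ Q.ord Q.localParam := by
    rw [Q.ord_localParam]
    exact fun h => hp.one_lt.not_ge (Nat.le_of_dvd one_pos (by exact_mod_cast h))
  obtain ⟨a, rfl⟩ := Q.exists_sum_pow p hL ht y
  refine ⟨_, D_sum_pow p a _, Place.Ge.sum fun i _ => ?_, fun hn => Place.Ge.sum fun i _ => ?_⟩
  all_goals
    rcases Nat.eq_zero_or_pos (i : ℕ) with hi | hi
    · rw [hi, Nat.cast_zero, zero_mul]; exact Q.ge_zero _
    have h1 := Q.ge_of_sum_pow p ht hy i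
    have h2 : Q.Ge (a i ^ p * Q.localParam ^ ((i : ℕ) - 1)) (n - 1) := by
      have h3 := Q.ge_mul_localParam (-1) h1
      obtain ⟨j, hj⟩ := Nat.exists_eq_add_of_lt hi
      rw [zero_add] at hj
      rwa [mul_assoc, zpow_neg_one, hj, pow_succ,
        mul_inv_cancel_right₀ Q.localParam_ne_zero, ← Nat.add_sub_cancel (n := j) (m := 1),
        ← hj] at h3
    have h4 := fun {m : ℤ} (h : Q.Ge (a i ^ p * Q.localParam ^ ((i : ℕ) - 1)) m) =>
      (Q.ge_natCast (i : ℕ)).mul h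
    simp only [zero_add] at h4
  · exact h4 h2
  · refine h4 ?_
    by_cases ha : a i = 0
    · rw [ha, zero_pow hp.ne_zero, zero_mul]; exact Q.ge_zero _
    have ha' := pow_ne_zero p ha
    have hl := fun m : ℕ => pow_ne_zero m Q.localParam_ne_zero
    have ho := fun m : ℕ => (Q.ord_mul ha' (hl m)).trans (by
      rw [Q.ord_pow, Q.ord_pow, Q.ord_localParam, mul_one])
    rw [Q.ge_iff (mul_ne_zero ha' (hl _)), ho] at h1 ⊢
    -- Since `i < p`, nonnegativity of `p * ord (a i) + i` already forces `ord (a i) ≥ 0`, so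
    -- lowering the exponent of the parameter creates no pole.
    have h5 : 0 ≤ Q.ord (a i) := by
      by_contra! h6
      have : (p : ℤ) * Q.ord (a i) ≤ p * (-1) := by gcongr; omega
      have := i.2
      omega
    positivity

/-- The differential of a local parameter, or of a function of order prime to `p`, spans the
module of differentials. -/
theorem exists_eq_smul_D [CharP k p] [PerfectField k] (hL : IsFunctionField k L) (Q : Place k L)
    {t : L} (ht : ¬ (p : ℤ) ∣ Q.ord t) (θ : Ω[L⁄k]) : ∃ c : L, θ = c • D k L t := by
  have h : θ ∈ Submodule.span L (Set.range (D k L)) := by rw [span_range_derivation]; trivial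
  induction h using Submodule.span_induction with
  | mem θ hθ =>
    obtain ⟨y, rfl⟩ := hθ
    obtain ⟨a, rfl⟩ := Q.exists_sum_pow p hL ht y
    exact ⟨_, D_sum_pow p a t⟩
  | zero => exact ⟨0, by simp⟩
  | add θ θ' _ _ h h' =>
    obtain ⟨c, rfl⟩ := h
    obtain ⟨c', rfl⟩ := h'
    exact ⟨c + c', by rw [add_smul]⟩
  | smul a θ _ h =>
    obtain ⟨c, rfl⟩ := h
    exact ⟨a * c, by rw [mul_smul]⟩

omit [CharP L p] in
theorem not_dvd_ord_localParam (Q : Place k L) : ¬ (p : ℤ) ∣ Q.ord Q.localParam := by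
  rw [Q.ord_localParam]
  exact fun h => (Fact.out : p.Prime).one_lt.not_ge (Nat.le_of_dvd one_pos (by exact_mod_cast h))

/-- The order of a differential form is defined. -/
theorem exists_ordForm [CharP k p] [PerfectField k] (hL : IsFunctionField k L) (Q : Place k L)
    (θ : Ω[L⁄k]) : ∃ c : L, θ = c • D k L Q.localParam ∧ Q.ord c = Q.ordForm θ := by
  have h := exists_eq_smul_D p hL Q (not_dvd_ord_localParam p Q) θ
  refine ⟨h.choose, h.choose_spec, ?_⟩
  rw [Place.ordForm, dif_pos h]

theorem ordForm_eq (Q : Place k L) {c : L} (h : c • D k L Q.localParam ≠ 0) :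
    Q.ordForm (c • D k L Q.localParam) = Q.ord c := by
  have hex : ∃ f : L, c • D k L Q.localParam = f • D k L Q.localParam := ⟨c, rfl⟩
  rw [Place.ordForm, dif_pos hex]
  congr 1
  by_contra hne
  have h1 : (c - hex.choose) • D k L Q.localParam = 0 := by
    rw [sub_smul, ← hex.choose_spec, sub_self]
  rw [smul_eq_zero, sub_eq_zero] at h1
  exact h (by rw [h1.resolve_left (Ne.symm hne), smul_zero])

/-- The form `w dx` is regular where `w` and `x` are. -/
theorem ordForm_nonneg [CharP k p] [PerfectField k] (hL : IsFunctionField k L) (Q : Place k L)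
    {w x : L} (h : w • D k L x ≠ 0) (hw : Q.Ge w 0) (hx : Q.Ge x 0) :
    0 ≤ Q.ordForm (w • D k L x) := by
  obtain ⟨c, hc, -, hc0⟩ := exists_D_eq_smul p hL Q hx
  have h1 := hw.mul (hc0 le_rfl)
  rw [hc, smul_smul] at h ⊢
  rw [ordForm_eq Q h]
  exact (Q.ge_iff fun h0 => h (by rw [h0, zero_smul])).1 h1

/-- A form has finitely many poles. -/
theorem finite_ordForm_neg [CharP k p] [PerfectField k] (hL : IsFunctionField k L) {w x : L}
    (h : w • D k L x ≠ 0) : {Q : Place k L | Q.ordForm (w • D k L x) < 0}.Finite := by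
  refine ((hL.finite_poles w).union (hL.finite_poles x)).subset fun Q hQ => ?_
  by_contra hn
  simp only [Set.mem_union, Set.mem_ofPred_eq, not_or, not_lt] at hn hQ
  exact hQ.not_ge (ordForm_nonneg p hL Q h ((Q.ge_ord w).mono hn.1) ((Q.ge_ord x).mono hn.2))

end derivations

end

/-! ### Expansions of forms, exactness, and the residue theorem for one pole. -/

section

section

variable {k : Type u} [Field k] (p : ℕ) [Fact p.Prime] [CharP k p]

/-- The coefficients of the `p`-th power of a Laurent series in characteristic `p`. -/
theorem coeff_pow_char (f : k⸨X⸩) (n : ℤ) :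
    (f ^ p).coeff n = if (p : ℤ) ∣ n then f.coeff (n / p) ^ p else 0 := by
  have hp : p.Prime := Fact.out
  have hp0 : (0 : ℤ) < p := by exact_mod_cast hp.pos
  have : CharP k⸨X⸩ p := charP_of_injective_algebraMap (algebraMap k k⸨X⸩).injective p
  have hcs : ∀ (i j : ℤ) (c : k), (HahnSeries.single j c).coeff i = if i = j then c else 0 := by
    intro i j c
    rw [HahnSeries.coeff_single]
    congr
  obtain ⟨a, ha⟩ := exists_lGe f
  set m : ℤ := n / p with hm
  set s := Finset.Icc a m with hs
  -- Additivity of Frobenius reduces the claim to a finite sum: the tail `g` has order above `n /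
  -- p`, so `g ^ p` does not reach degree `n`.
  set g : k⸨X⸩ := f - ∑ i ∈ s, HahnSeries.single i (f.coeff i) with hg
  have hgm : LGe g (m + 1) := by
    intro i hi
    rw [hg, HahnSeries.coeff_sub, HahnSeries.coeff_sum]
    simp only [hcs, Finset.sum_ite_eq]
    split_ifs with his
    · exact sub_self _
    · rw [sub_zero]
      exact ha i (by simp only [hs, Finset.mem_Icc, not_and, not_le] at his; by_contra! h; have := his h; omega)
  have hlt : n < p * (m + 1) := by
    have := Int.lt_mul_ediv_self_add (x := n) hp0
    rw [mul_add, mul_one]; omega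
  have hf : f ^ p = ∑ i ∈ s, HahnSeries.single ((p : ℤ) * i) (f.coeff i ^ p) + g ^ p := by
    have h1 : f = ∑ i ∈ s, HahnSeries.single i (f.coeff i) + g := by rw [hg]; ring
    conv_lhs => rw [h1]
    rw [add_pow_char, sum_pow_char]
    congr 1
    refine Finset.sum_congr rfl fun i _ => ?_
    rw [HahnSeries.single_pow, nsmul_eq_mul]
  rw [hf, HahnSeries.coeff_add, hgm.pow p n hlt, add_zero, HahnSeries.coeff_sum]
  simp only [hcs]
  split_ifs with hd
  · have hn : n = p * m := (Int.mul_ediv_cancel' hd).symm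
    rw [Finset.sum_eq_single m]
    · rw [if_pos hn]
    · intro i _ him
      rw [if_neg]
      intro h
      exact him (mul_left_cancel₀ hp0.ne' (h.symm.trans hn))
    · intro hms
      rw [if_pos hn, ha m (by simp only [hs, Finset.mem_Icc, not_and, not_le] at hms; by_contra! h; exact (hms h).ne rfl),
        zero_pow hp.ne_zero]
  · refine Finset.sum_eq_zero fun i _ => if_neg ?_
    rintro rfl
    exact hd (dvd_mul_right _ _)

end

section

variable {k : Type u} {L : Type v} [Field k] [Field L] [Algebra k L]

open KaehlerDifferential

/-- The expansion of differential forms. -/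
theorem exists_expansion_form (φ : L →ₐ[k] k⸨X⸩) : ∃ Ψ : Ω[L⁄k] →+ k⸨X⸩,
    (∀ f θ, Ψ (f • θ) = φ f * Ψ θ) ∧ ∀ g, Ψ (D k L g) = LaurentSeries.derivative k (φ g) := by
  let _ : Module L k⸨X⸩ := Module.compHom _ φ.toRingHom
  have hsm : ∀ (f : L) (s : k⸨X⸩), f • s = φ f * s := fun _ _ => rfl
  have hk : ∀ (c : k) (s : k⸨X⸩), c • s = HahnSeries.C c * s := fun c s => by
    rw [HahnSeries.C_mul_eq_smul]
  have : IsScalarTower k L k⸨X⸩ := ⟨fun c f s => by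
    rw [hsm, hsm, hk, Algebra.smul_def, map_mul, algHom_algebraMap, mul_assoc]⟩
  let d : Derivation k L k⸨X⸩ := Derivation.mk'
    { toFun := fun f => LaurentSeries.derivative k (φ f)
      map_add' := fun f g => by rw [map_add, map_add]
      map_smul' := fun c f => by
        rw [Algebra.smul_def, map_mul, algHom_algebraMap, derivative_C_mul, RingHom.id_apply, hk] }
    fun f g => by
      simp only [LinearMap.coe_mk, AddHom.coe_mk, hsm]
      rw [map_mul, derivative_mul]
  refine ⟨d.liftKaehlerDifferential.toAddMonoidHom, fun f θ => ?_, fun g => ?_⟩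
  · exact map_smul d.liftKaehlerDifferential f θ
  · exact d.liftKaehlerDifferential_comp_D g

end

variable {k : Type u} {L : Type v} [Field k] [Field L] [Algebra k L] (p : ℕ) [Fact p.Prime]
  [CharP k p] [CharP L p] [PerfectField k]

open KaehlerDifferential

/-- A form `w dx` is exact if the coefficients of degree congruent to `-1` modulo `p` of the
expansion of `w` vanish. -/
theorem IsFunctionField.exact_of_coeff_eq_zero (hL : IsFunctionField k L) {P : Place k L}
    {φ : L →ₐ[k] k⸨X⸩} {x : L} (hx : φ x = HahnSeries.single 1 1) (hPx : P.ord x = 1) {w : L}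
    (h : ∀ m : ℤ, (φ w).coeff (m * p - 1) = 0) : ∃ f : L, D k L f = w • D k L x := by
  have hp : p.Prime := Fact.out
  have hpx : ¬ (p : ℤ) ∣ P.ord x := by
    rw [hPx, ← P.ord_localParam]; exact not_dvd_ord_localParam p P
  obtain ⟨a, rfl⟩ := P.exists_sum_pow p hL hpx w
  -- Only the term with `x ^ (p - 1)` has exponents congruent to `-1` modulo `p`. The others can be
  -- integrated, because `i + 1` is invertible in `k`.
  have hlast : ∀ i : Fin p, (i : ℕ) + 1 = p → a i = 0 := by
    intro i hi
    refine φ.injective ?_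
    rw [map_zero]
    ext m
    have h1 := h (m + 1)
    rw [map_sum, HahnSeries.coeff_sum, Finset.sum_eq_single i] at h1
    · rw [map_mul, map_pow, map_pow, hx, HahnSeries.single_pow, one_pow,
        show (m + 1) * p - 1 = m * p + (i : ℕ) • (1 : ℤ) by
          rw [nsmul_one]; have : ((i : ℕ) : ℤ) + 1 = p := by exact_mod_cast hi
          linarith,
        HahnSeries.coeff_mul_single_add, mul_one, coeff_pow_char, if_pos (dvd_mul_left _ _),
        Int.mul_ediv_cancel _ (by exact_mod_cast hp.ne_zero)] at h1
      exact eq_zero_of_pow_eq_zero h1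
    · intro j _ hji
      rw [map_mul, map_pow, map_pow, hx, HahnSeries.single_pow, one_pow,
        show (m + 1) * p - 1 = ((m + 1) * p - 1 - j) + (j : ℕ) • (1 : ℤ) by
          rw [nsmul_one]; ring,
        HahnSeries.coeff_mul_single_add, mul_one, coeff_pow_char, if_neg]
      rintro hd
      have h2 : (p : ℤ) ∣ (j : ℤ) + 1 := by
        have := dvd_sub (dvd_mul_left (p : ℤ) (m + 1)) hd
        rwa [show (m + 1) * (p : ℤ) - ((m + 1) * p - 1 - j) = (j : ℤ) + 1 by ring] at this
      have h3 : p ∣ (j : ℕ) + 1 := by exact_mod_cast h2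
      have h4 := Nat.le_of_dvd (Nat.succ_pos _) h3
      exact hji (Fin.ext (by omega))
    · intro hi'; exact absurd (Finset.mem_univ i) hi'
  refine ⟨∑ i : Fin p, (((i : ℕ) + 1 : ℕ) : k)⁻¹ • (a i ^ p * x ^ ((i : ℕ) + 1)), ?_⟩
  rw [map_sum, Finset.sum_smul]
  refine Finset.sum_congr rfl fun i _ => ?_
  by_cases hi : (i : ℕ) + 1 = p
  · rw [hlast i hi, zero_pow hp.ne_zero, zero_mul, zero_mul, smul_zero, map_zero, zero_smul]
  have hne : (((i : ℕ) + 1 : ℕ) : k) ≠ 0 := by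
    rw [Ne, CharP.cast_eq_zero_iff k p]
    intro hd
    have := Nat.le_of_dvd (Nat.succ_pos _) hd
    omega
  rw [Derivation.map_smul, D_pow_mul, Derivation.leibniz_pow, Nat.add_sub_cancel, ← Nat.cast_smul_eq_nsmul k,
    smul_comm (a i ^ p), inv_smul_smul₀ hne, smul_smul]

omit [Fact p.Prime] [CharP k p] [CharP L p] [PerfectField k] in
theorem exists_nat_bound (S : Finset (Place k L)) (c : Place k L → ℤ) :
    ∃ M : ℕ, ∀ Q ∈ S, c Q ≤ M :=
  ⟨S.sup fun Q => (c Q).toNat, fun Q hQ => (Int.self_le_toNat _).trans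
    (by exact_mod_cast Finset.le_sup (f := fun Q => (c Q).toNat) hQ)⟩

include p in
/-- The residue theorem for a form that is regular outside one place `P`, of degree one. -/
theorem IsFunctionField.residue_eq_zero (hL : IsFunctionField k L) {P : Place k L}
    (hP : P.deg = 1) {φ : L →ₐ[k] k⸨X⸩} (hφ : ∀ (f : L) (n : ℤ), P.Ge f n ↔ LGe (φ f) n)
    {x : L} (hx : φ x = HahnSeries.single 1 1) (hPx : P.ord x = 1) {Ψ : Ω[L⁄k] →+ k⸨X⸩}
    (hΨ : ∀ f θ, Ψ (f • θ) = φ f * Ψ θ)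
    (hΨD : ∀ g, Ψ (D k L g) = LaurentSeries.derivative k (φ g)) {θ : Ω[L⁄k]}
    (hθ : ∀ Q : Place k L, ∃ a : L, θ = a • D k L Q.localParam ∧ (Q ≠ P → Q.Ge a 0)) :
    (Ψ θ).coeff (-1) = 0 := by
  classical
  have hp : p.Prime := Fact.out
  by_cases hθ0 : θ = 0
  · rw [hθ0, map_zero, HahnSeries.coeff_zero]
  have hx0 : x ≠ 0 := by rintro rfl; simp at hPx
  choose a ha ha0 using hθ
  obtain ⟨N, hN⟩ := hL.exists_principal_part hP
  -- The pole order `N * p + 1` is prime to `p`, so `dt` spans the forms, and it exceeds `N`, so a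
  -- function regular outside `P` attains it.
  obtain ⟨t, htreg, htN⟩ := hN (x ^ (-(N * p + 1 : ℤ)))
  have htord : ¬ (p : ℤ) ∣ P.ord t := by
    have h1 : P.ord (x ^ (-(N * p + 1 : ℤ))) = -(N * p + 1) := by rw [P.ord_zpow, hPx, mul_one]
    have h2 := P.ord_add_eq (zpow_ne_zero (-(N * p + 1 : ℤ)) hx0) (g := t - x ^ (-(N * p + 1 : ℤ)))
      (htN.mono (by
        rw [h1]
        have : (N : ℤ) * 1 ≤ N * p := by gcongr; exact_mod_cast hp.one_le
        omega))
    rw [add_sub_cancel, h1] at h2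
    rw [h2.2, dvd_neg, Int.dvd_add_right (dvd_mul_left _ _), ← P.ord_localParam]
    exact not_dvd_ord_localParam p P
  obtain ⟨h, hh⟩ := exists_eq_smul_D p hL P htord θ
  choose τ hτ using fun Q : Place k L => exists_eq_smul_D p hL Q (not_dvd_ord_localParam p Q) (D k L t)
  have hDne : ∀ Q : Place k L, D k L Q.localParam ≠ 0 := fun Q h0 => hθ0 (by
    rw [ha Q, h0, smul_zero])
  have hcancel : ∀ (Q : Place k L) {b c : L}, b • D k L Q.localParam = c • D k L Q.localParam →
      b = c := fun Q b c hbc => by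
    rw [← sub_eq_zero, ← sub_smul, smul_eq_zero, sub_eq_zero] at hbc
    exact hbc.resolve_right (hDne Q)
  have hhτ : ∀ Q, h * τ Q = a Q := fun Q => hcancel Q (by
    rw [mul_smul, ← hτ, ← hh, ← ha])
  have hτ0 : ∀ Q, τ Q ≠ 0 := fun Q h0 => hθ0 (by
    rw [ha Q, ← hhτ, h0, mul_zero, zero_smul])
  set S : Finset (Place k L) := (hL.finite_poles h).toFinset.erase P with hS
  have hmemS : ∀ Q, Q ≠ P → Q ∉ S → Q.Ge h 0 := fun Q hQ hQS => by
    refine (Q.ge_ord h).mono ?_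
    simpa [hS, hQ] using hQS
  have hSP : ∀ Q ∈ S, Q ≠ P := fun Q hQ => (Finset.mem_erase.1 hQ).1
  -- In `θ = h dt` the coefficient may have poles in `S`, at zeros of `dt`. There `a' db` is made to
  -- imitate `a Q` times the differential of a local parameter; the precision `M` offsets the order
  -- of `τ Q` and the unit lost by differentiation.
  obtain ⟨M, hM⟩ := exists_nat_bound S fun Q => 1 + Q.ord (τ Q)
  obtain ⟨b, hbreg, hb⟩ := hL.exists_strong_approx hP S (Finset.notMem_erase _ _) M
    (fun Q => Q.localParam) fun Q _ =>
      (Q.ge_ord _).mono (by rw [Q.ord_localParam]; exact zero_le_one)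
  obtain ⟨β, hβ⟩ := exists_eq_smul_D p hL P htord (D k L b)
  set S' : Finset (Place k L) := S ∪ (hL.finite_poles β).toFinset.erase P with hS'
  have hmemS' : ∀ Q, Q ≠ P → Q ∉ S' → Q.Ge β 0 := fun Q hQ hQS => by
    refine (Q.ge_ord β).mono ?_
    simp only [hS', Finset.mem_union, not_or] at hQS
    simpa [hQ] using hQS.2
  have hS'P : ∀ Q ∈ S', Q ≠ P := fun Q hQ => by
    rcases Finset.mem_union.1 hQ with h | h
    exacts [hSP Q h, (Finset.mem_erase.1 h).1]
  -- In `db = β dt` new poles may appear outside `S`; `a'` is made to vanish enough there.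
  obtain ⟨M', hM'⟩ := exists_nat_bound S' fun Q => -Q.ord β
  obtain ⟨a', hareg, ha'⟩ := hL.exists_strong_approx hP S' (fun h => hS'P P h rfl) (M + M')
    (fun Q => if Q ∈ S then a Q else 0) fun Q hQ => by
      split_ifs
      exacts [ha0 Q (hS'P Q hQ), Q.ge_zero 0]
  have hh' : ∀ Q, Q ≠ P → Q.Ge (h - a' * β) 0 := by
    intro Q hQ
    by_cases hQS : Q ∈ S
    · obtain ⟨c, hc, hcM, -⟩ := exists_D_eq_smul p hL Q (hb Q hQS)
      have hβτ : β * τ Q = 1 + c := hcancel Q (by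
        rw [mul_smul, ← hτ, ← hβ, add_smul, ← hc, map_sub, one_smul, add_sub_cancel])
      have h1 := ha' Q (Finset.mem_union_left _ hQS)
      rw [if_pos hQS] at h1
      have h2 : h - a' * β = -((a' - a Q) + a' * c) * (τ Q)⁻¹ := by
        rw [eq_mul_inv_iff_mul_eq₀ (hτ0 Q), sub_mul, hhτ, mul_assoc, hβτ]; ring
      have h3 : Q.Ge (-((a' - a Q) + a' * c)) (M - 1) :=
        ((h1.mono (by push_cast; omega)).add (by simpa using (hareg Q hQ).mul hcM)).neg
      have h4 := Q.ge_ord (τ Q)⁻¹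
      rw [Q.ord_inv] at h4
      rw [h2]
      exact (h3.mul h4).mono (by have := hM Q hQS; omega)
    · refine (hmemS Q hQ hQS).sub ?_
      by_cases hQS' : Q ∈ S'
      · have h1 := ha' Q hQS'
        rw [if_neg hQS, sub_zero] at h1
        exact (h1.mul (Q.ge_ord β)).mono (by have := hM' Q hQS'; push_cast; omega)
      · simpa using (hareg Q hQ).mul (hmemS' Q hQ hQS')
  have hdecomp : θ = a' • D k L b + (h - a' * β) • D k L t := by
    rw [hβ, smul_smul, ← add_smul, hh]; congr 1; ring
  rw [hdecomp, map_add, hΨ, hΨ, hΨD, hΨD, HahnSeries.coeff_add,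
    hL.residue_mul_derivative_eq_zero hP hφ hx hareg hbreg,
    hL.residue_mul_derivative_eq_zero hP hφ hx hh' htreg, add_zero]

end

/-! ### From a gap at `P` to a bound on the degree. -/

section

variable {k : Type u} {L : Type v} [Field k] [Field L] [Algebra k L]

/-- If the functions that are bounded by `D` away from `P` never have a pole of order exactly
`D(P) + 1` at `P`, then the degree of `D` is at most `2g - 2`. -/
theorem IsFunctionField.divDeg_le_of_gap (hL : IsFunctionField k L) {P : Place k L}
    (hP : P.deg = 1) {D : Place k L →₀ ℤ}
    (hgap : ∀ f, (∀ Q, Q ≠ P → Q.Ge f (-D Q)) → P.Ge f (-D P - 1) → P.Ge f (-D P)) :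
    divDeg k L D ≤ 2 * genus k L - 2 := by
  classical
  have hdeg : ∀ n : ℤ, divDeg k L (Finsupp.single P n) = n := fun n => by
    rw [divDeg_single, hP, Nat.cast_one, mul_one]
  have hsQ : ∀ (n : ℤ) {Q : Place k L}, Q ≠ P → Finsupp.single P n Q = 0 := fun n Q hQ =>
    Finsupp.single_eq_of_ne hQ
  have hmono : ∀ {D' D'' : Place k L →₀ ℤ}, rrSpace k L D' ≤ rrSpace k L D'' →
      rrDim k L D' ≤ rrDim k L D'' := fun {D' D''} h => by
    have := hL.finiteDimensional_rrSpace hP D''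
    exact Submodule.finrank_mono h
  have h1 : rrDim k L (D + Finsupp.single P 1) ≤ rrDim k L D := hmono fun f hf => by
    rw [mem_rrSpace] at hf ⊢
    have hfQ : ∀ Q, Q ≠ P → Q.Ge f (-D Q) := fun Q hQ => by
      simpa [hsQ 1 hQ] using hf Q
    intro Q
    by_cases hQ : Q = P
    · subst hQ
      exact hgap f hfQ ((hf Q).mono (by rw [Finsupp.add_apply, Finsupp.single_eq_same]; omega))
    · exact hfQ Q hQ
  -- At each `n` at most one of two jumps occurs: from `L(D - (n+1)P)` to `L(D - nP)`, or from
  -- `L(nP)` to `L((n+1)P)`. If both did, the product of two new functions would have at `P` a pole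
  -- of order exactly `D P + 1`.
  have h2 : ∀ n : ℕ, rrDim k L D + rrDim k L (Finsupp.single P (n : ℤ)) ≤
      rrDim k L (D - Finsupp.single P (n : ℤ)) + rrDim k L 0 + n := by
    intro n
    induction n with
    | zero => simp
    | succ n ih =>
      have e1 : D - Finsupp.single P ((n + 1 : ℕ) : ℤ) + Finsupp.single P 1 =
          D - Finsupp.single P (n : ℤ) := by
        rw [Nat.cast_succ, Finsupp.single_add]; abel
      have e2 : Finsupp.single P (n : ℤ) + Finsupp.single P 1 =
          Finsupp.single P ((n + 1 : ℕ) : ℤ) := by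
        rw [Nat.cast_succ, Finsupp.single_add]
      have s1 := hL.rrDim_add_single_le hP (D - Finsupp.single P ((n + 1 : ℕ) : ℤ)) P
      have s2 := hL.rrDim_add_single_le hP (Finsupp.single P (n : ℤ)) P
      rw [e1, hP] at s1
      rw [e2, hP] at s2
      by_cases c1 : rrSpace k L (D - Finsupp.single P (n : ℤ)) ≤
          rrSpace k L (D - Finsupp.single P ((n + 1 : ℕ) : ℤ))
      · have := hmono c1
        omega
      by_cases c2 : rrSpace k L (Finsupp.single P ((n + 1 : ℕ) : ℤ)) ≤
          rrSpace k L (Finsupp.single P (n : ℤ))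
      · have := hmono c2
        omega
      exfalso
      obtain ⟨f, hf, hf'⟩ := SetLike.not_le_iff_exists.1 c1
      obtain ⟨r, hr, hr'⟩ := SetLike.not_le_iff_exists.1 c2
      have hf0 : f ≠ 0 := by rintro rfl; exact hf' (zero_mem _)
      have hr0 : r ≠ 0 := by rintro rfl; exact hr' (zero_mem _)
      rw [mem_rrSpace_single] at hr hr'
      rw [mem_rrSpace] at hf hf'
      have hfQ : ∀ Q, Q ≠ P → Q.Ge f (-D Q) := fun Q hQ => by
        simpa [Finsupp.single_eq_of_ne hQ] using hf Q
      have hfP : ¬ P.Ge f (-(D P - (n + 1))) := fun h => hf' fun Q => by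
        by_cases hQ : Q = P
        · subst hQ; simpa using h
        · simpa [Finsupp.single_eq_of_ne hQ] using hfQ Q hQ
      have hfP' : P.Ge f (-(D P - n)) := by simpa using hf P
      have hrP : ¬ P.Ge r (-n) := fun h => hr' ⟨hr.1, h⟩
      have hrP' := hr.2
      rw [P.ge_iff hf0] at hfP hfP'
      rw [P.ge_iff hr0] at hrP hrP'
      push_cast at hrP'
      have h3 := hgap (f * r) (fun Q hQ => by simpa using (hfQ Q hQ).mul (hr.1 Q hQ))
      rw [P.ge_iff (mul_ne_zero hf0 hr0), P.ge_iff (mul_ne_zero hf0 hr0),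
        P.ord_mul hf0 hr0] at h3
      omega
  -- With `n > deg D` the space `L(D - nP)` is zero. Riemann's inequality for `nP` and for `D + P`
  -- then closes the estimate.
  set n : ℕ := (divDeg k L D).toNat + 1 with hn
  have h3 := h2 n
  rw [hL.rrDim_eq_zero_of_divDeg_neg hP (D := D - Finsupp.single P (n : ℤ))
    (by rw [divDeg_sub, hdeg]; omega)] at h3
  have h4 := hL.rrDim_zero_le hP
  have h5 := hL.le_genus hP (Finsupp.single P (n : ℤ))
  have h6 := hL.le_genus hP (D + Finsupp.single P 1)
  rw [hdeg] at h5
  rw [divDeg_add, hdeg] at h6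
  omega

theorem poleSum_eq {ξ : Ω[L⁄k]} {S : Finset (Place k L)} (hS : ∀ Q, Q ∈ S ↔ Q.ordForm ξ < 0) :
    poleSum k ξ = ∑ Q ∈ S, (Q.deg : ℤ) * Q.ordForm ξ :=
  finsum_cond_eq_sum_of_cond_iff _ fun {Q} _ => (hS Q).symm

theorem degFun_nonneg (f : L) : 0 ≤ degFun k f :=
  finsum_nonneg fun _ => finsum_nonneg fun h => mul_nonneg (Nat.cast_nonneg _) (by omega)

/-- The residue of `fᵖ w dx`, if `f` has a pole of order at most `m` and the coefficients of
degree `jp - 1`, `j < m`, of `w` vanish. -/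
theorem coeff_pow_mul_coe (p : ℕ) [Fact p.Prime] [CharP k p] {f : k⸨X⸩} {m : ℕ} (hm : 1 ≤ m)
    (hf : LGe f (-m)) {W : k⟦X⟧} (hW : ∀ j, 1 ≤ j → j < m → PowerSeries.coeff (j * p - 1) W = 0) :
    (f ^ p * (W : k⸨X⸩)).coeff (-1) = f.coeff (-m) ^ p * PowerSeries.coeff (m * p - 1) W := by
  have hp : p.Prime := Fact.out
  have hp0 : (0 : ℤ) < p := by exact_mod_cast hp.pos
  have hW0 : LGe (W : k⸨X⸩) 0 := fun i hi => by
    rw [PowerSeries.coeff_coe, if_pos hi]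
  have hcast : ∀ j : ℕ, 1 ≤ j → ((j * p - 1 : ℕ) : ℤ) = j * p - 1 := fun j hj => by
    rw [Nat.cast_sub (Nat.mul_pos hj hp.pos)]; push_cast; rfl
  have hcoeff : ∀ j : ℕ, 1 ≤ j →
      (W : k⸨X⸩).coeff (-1 - p * (-j : ℤ)) = PowerSeries.coeff (j * p - 1) W := fun j hj => by
    rw [show -1 - p * (-j : ℤ) = ((j * p - 1 : ℕ) : ℤ) by rw [hcast j hj]; ring,
      LaurentSeries.coeff_coe_powerSeries]
  -- `f ^ p` has only exponents `-jp`, which pair with the coefficient of degree `jp - 1` in `W`;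
  -- these vanish for `1 ≤ j < m`, and `j > m` exceeds the pole.
  rw [coeff_mul_eq_sum (hf.pow p) hW0, Finset.sum_eq_single (p * (-m : ℤ))]
  · rw [coeff_pow_char, if_pos (dvd_mul_right _ _), Int.mul_ediv_cancel_left _ hp0.ne',
      hcoeff m hm]
  · intro i hi him
    rw [coeff_pow_char]
    split_ifs with hd
    · obtain ⟨j, rfl⟩ := hd
      rw [Finset.mem_Icc] at hi
      have h1 : -(m : ℤ) ≤ j := le_of_mul_le_mul_left hi.1 hp0
      have h2 : j < 0 := by
        by_contra! h
        have := mul_nonneg hp0.le h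
        omega
      have h3 : j ≠ -m := fun h => him (by rw [h])
      obtain ⟨l, rfl⟩ : ∃ l : ℕ, j = -l := ⟨j.natAbs, by omega⟩
      rw [hcoeff l (by omega), hW l (by omega) (by omega), mul_zero]
    · rw [zero_mul]
  · intro h
    refine absurd (Finset.mem_Icc.2 ⟨le_rfl, ?_⟩) h
    have : (p : ℤ) * 1 ≤ p * m := by gcongr; exact_mod_cast hm
    linarith

end

end CurveFF

end

/-! ### The main theorem. -/

open CurveFF in
theorem propositionP {k₀ : Type*} {L : Type*} [Field k₀] [PerfectField k₀]
    (p : ℕ) [Fact p.Prime] [CharP k₀ p]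
    [Field L] [Algebra k₀ L] (hL : CurveFF.IsFunctionField k₀ L)
    -- the place at which `x` is a local parameter, as an expansion in powers of `x`
    (φ : L →ₐ[k₀] k₀⸨X⸩) (x : L) (hx : φ x = ((PowerSeries.X : k₀⟦X⟧) : k₀⸨X⸩))
    (w : L) (W : k₀⟦X⟧) (hw : φ w = (W : k₀⸨X⸩))
    (ξ : Ω[L⁄k₀]) (hξ : ξ = w • KaehlerDifferential.D k₀ L x)
    (hexact : ¬ ∃ f : L, KaehlerDifferential.D k₀ L f = ξ) :
    ∃ m : ℕ, 1 ≤ m ∧ PowerSeries.coeff (m * p - 1) W ≠ 0 ∧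
      (m : ℤ) ≤ -CurveFF.poleSum k₀ ξ + 2 * CurveFF.genus k₀ L - 1
        + CurveFF.degFun k₀ x + (CurveFF.numPoles k₀ x : ℤ) := by
  classical
  have hp : p.Prime := Fact.out
  have : CharP L p := charP_of_injective_algebraMap (algebraMap k₀ L).injective p
  have hx1 : φ x = HahnSeries.single 1 1 := by rw [hx, PowerSeries.coe_X]
  obtain ⟨P, hP, hφ⟩ := hL.exists_place φ x hx1
  have hx0 : x ≠ 0 := by
    rintro rfl
    rw [map_zero, eq_comm, HahnSeries.single_eq_zero_iff] at hx1
    exact one_ne_zero hx1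
  have hPx : P.ord x = 1 := by
    have h1 : P.Ge x 1 := by
      rw [hφ, hx1]
      exact fun i hi => HahnSeries.coeff_single_of_ne hi.ne
    have h2 : ¬ P.Ge x 2 := by
      rw [hφ, hx1]
      intro h
      have := h 1 one_lt_two
      rw [HahnSeries.coeff_single_same] at this
      exact one_ne_zero this
    rw [P.ge_iff hx0] at h1 h2
    omega
  have hW0 : LGe (φ w) 0 := fun i hi => by rw [hw, PowerSeries.coeff_coe, if_pos hi]
  have hξ0 : w • KaehlerDifferential.D k₀ L x ≠ 0 := fun h =>
    hexact ⟨0, by rw [map_zero, hξ, h]⟩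
  have hex : ∃ m : ℕ, 1 ≤ m ∧ PowerSeries.coeff (m * p - 1) W ≠ 0 := by
    by_contra! h
    refine hexact (hξ ▸ hL.exact_of_coeff_eq_zero p hx1 hPx fun m => ?_)
    by_cases hm : m ≤ 0
    · refine hW0 _ ?_
      have := mul_nonpos_of_nonpos_of_nonneg hm (Nat.cast_nonneg (α := ℤ) p)
      omega
    · obtain ⟨l, rfl⟩ : ∃ l : ℕ, m = l := ⟨m.toNat, by omega⟩
      have hl : 1 ≤ l := by omega
      rw [hw, show (l : ℤ) * p - 1 = ((l * p - 1 : ℕ) : ℤ) by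
        rw [Nat.cast_sub (Nat.mul_pos hl hp.pos)]; push_cast; rfl,
        LaurentSeries.coeff_coe_powerSeries]
      exact h l hl
  obtain ⟨hm1, hmW⟩ := Nat.find_spec hex
  have hmin : ∀ j, 1 ≤ j → j < Nat.find hex → PowerSeries.coeff (j * p - 1) W = 0 :=
    fun j hj hlt => by
      have := Nat.find_min hex hlt
      push Not at this
      exact this hj
  refine ⟨Nat.find hex, hm1, hmW, ?_⟩
  generalize Nat.find hex = m at hm1 hmW hmin
  obtain ⟨Ψ, hΨ, hΨD⟩ := exists_expansion_form φ
  have hΨξ : Ψ ξ = (W : k₀⸨X⸩) := by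
    rw [hξ, hΨ, hΨD, hx1, hw]
    convert mul_one _
    ext n
    rw [coeff_derivative, HahnSeries.coeff_one]
    by_cases hn : n = 0
    · subst hn; simp
    · rw [if_neg hn, HahnSeries.coeff_single_of_ne (by omega), mul_zero]
  choose c hc hcord using fun Q : Place k₀ L => exists_ordForm p hL Q ξ
  have hfin : {Q : Place k₀ L | Q.ordForm ξ < 0}.Finite := hξ ▸ finite_ordForm_neg p hL hξ0
  have hmemS : ∀ Q, Q ∈ hfin.toFinset ↔ Q.ordForm ξ < 0 := fun Q => by simp
  -- Truncation at `0` ignores the zeros of `ξ`, so that the degree of `E` is the sum over the poles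
  -- alone.
  set E : Place k₀ L →₀ ℤ := Finsupp.onFinset hfin.toFinset (fun Q => min (Q.ordForm ξ) 0)
    (fun Q hQ => by rw [hmemS]; by_contra! h; exact hQ (min_eq_right h)) with hE
  have hEQ : ∀ Q, E Q = min (Q.ordForm ξ) 0 := fun Q => rfl
  have hEP : E P = 0 := by
    rw [hEQ, hξ]
    exact min_eq_right (ordForm_nonneg p hL P hξ0 ((hφ _ _).2 hW0)
      ((P.ge_ord x).mono (by rw [hPx]; exact zero_le_one)))
  have hdegE : divDeg k₀ L E = poleSum k₀ ξ := by
    rw [poleSum_eq hmemS, divDeg, hE, Finsupp.onFinset_sum _ fun Q => zero_mul _]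
    refine Finset.sum_congr rfl fun Q hQ => ?_
    rw [min_eq_left ((hmemS Q).1 hQ).le, mul_comm]
  have hDP : (E + Finsupp.single P ((m : ℤ) - 1)) P = m - 1 := by simp [hEP]
  have hDQ : ∀ Q, Q ≠ P → (E + Finsupp.single P ((m : ℤ) - 1)) Q = E Q := fun Q hQ => by
    simp [Finsupp.single_eq_of_ne hQ]
  have hmain := hL.divDeg_le_of_gap hP (D := E + Finsupp.single P ((m : ℤ) - 1))
    fun f hf hfP => by
      rw [hDP] at hfP ⊢
      have hfm : LGe (φ f) (-m) := (hφ _ _).1 (hfP.mono (by omega))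
      have hres : (Ψ (f ^ p • ξ)).coeff (-1) = 0 :=
        hL.residue_eq_zero p hP hφ hx1 hPx hΨ hΨD fun Q =>
          ⟨f ^ p * c Q, by rw [mul_smul, ← hc], fun hQ => by
            have h1 := hf Q hQ
            rw [hDQ Q hQ, hEQ] at h1
            refine ((h1.pow p).mul (Q.ge_ord (c Q))).mono ?_
            rw [hcord]
            -- Vanishing of `f` to the order of the pole suffices, since `f ^ p` vanishes `p ≥ 1`
            -- times as much.
            have h2 : (1 : ℤ) * -min (Q.ordForm ξ) 0 ≤ p * -min (Q.ordForm ξ) 0 := by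
              gcongr
              · omega
              · exact_mod_cast hp.one_le
            omega⟩
      rw [hΨ, hΨξ, map_pow, coeff_pow_mul_coe p hm1 hfm hmin, mul_eq_zero] at hres
      have h0 := eq_zero_of_pow_eq_zero (hres.resolve_right hmW)
      rw [hφ]
      intro i hi
      rcases eq_or_ne i (-m) with rfl | hne
      · exact h0
      · exact hfm i (by omega)
  rw [divDeg_add, hdegE, divDeg_single, hP] at hmain
  -- The bound already holds without `deg x + N_x`; only the nonnegativity of these terms is needed.
  have := degFun_nonneg (k := k₀) x
  push_cast at hmain
  omega
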